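/- Let $B$ be a real or complex Banach space and let $A$ be the generator of a strongly continuous cosine family $(T(t))_{t\ge 0}$ of bounded linear operators in $B$, that is, $T(0)=I$, $T(t+s)+T(|t-s|)=2T(t)T(s)$ for $s,t\ge 0$, $t\mapsto T(t)x$ is continuous on $[0,\infty)$ for every $x\in B$, and $Ax=\lim_{t\to 0+}2t^{-2}(T(t)x-x)$, with $D(A)$ the set of those $x$ for which the limit exists. For $\alpha>0$, an $\alpha$-times resolvent family for a linear operator $G$ in $B$ with domain $D(G)$ is a strongly continuous family $(S(t))_{t\ge 0}$ of bounded linear operators in $B$ with $S(0)=I$ such that, for all $x\in D(G)$ and $t\ge 0$, $S(t)x\in D(G)$, $GS(t)x=S(t)Gx$ and $S(t)x=x+\int_0^t \frac{(t-\tau)^{\alpha-1}}{\Gamma(\alpha)}\,G S(\tau)x\,d\tau$. There are constants $M\ge 1$ and $\omega\ge 0$ such that $\|T(t)\|\le Me^{\sqrt{\omega}\,t}$ for all $t\ge 0$. For any such $M,\omega$ and each $0<\alpha<2$ there exist an $\alpha$-times resolvent family $(S_\alpha(t))_{t\ge 0}$ for $A$, a constant $C>0$, bounded linear operators $A_n$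 in $B$ ($n\in\mathbb N$), and $\alpha$-times resolvent families $(S_{\alpha,n}(t))_{t\ge 0}$ for $A_n$ such that $\|S_{\alpha,n}(t)\|\le MCe^{(2\omega)^{1/\alpha}t}$ for all $t\ge 0$, $n\in\mathbb N$, and $S_{\alpha,n}(t)x\to S_\alpha(t)x$ as $n\to\infty$ for all $x\in B$ and $t\ge 0$; moreover, for each $x\in B$ the convergence is uniform in $t$ on every compact subset of $[0,\infty)$. -/

import Mathlib

open Filter Topology Set

section

variable {𝕜 : Type*} [RCLike 𝕜] {B : Type*} [NormedAddCommGroup B] [NormedSpace 𝕜 B]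

/-- The value `A x` of an unbounded operator `A`, with the value `0` outside the domain of `A`. -/
noncomputable def opValue (A : B →ₗ.[𝕜] B) (x : B) : B :=
  open Classical in if hx : x ∈ A.domain then A ⟨x, hx⟩ else 0

/-- A bounded operator, regarded as an operator with domain the whole space. -/
def boundedOp (A : B →L[𝕜] B) : B →ₗ.[𝕜] B :=
  (A : B →ₗ[𝕜] B).toPMap ⊤

/-- The kernel `g_α(t) = t ^ (α - 1) / Γ(α)`. -/
noncomputable def fracKernel (α : ℝ) (t : ℝ) : ℝ :=
  t ^ (α - 1) / Real.Gamma α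

/-- Strongly continuous cosine families `(T(t))_{t ≥ 0}` of bounded operators. The functional
equation is that of the even extension of `T` to the real line. Only the values `T t` with
`0 ≤ t` matter. -/
structure IsCosineFamily (T : ℝ → B →L[𝕜] B) : Prop where
  zero : T 0 = ContinuousLinearMap.id 𝕜 B
  add_sub : ∀ s t : ℝ, 0 ≤ s → 0 ≤ t → ∀ x : B,
    T (t + s) x + T |t - s| x = (2 : 𝕜) • T t (T s x)
  strongCont : ∀ x : B, ContinuousOn (fun t => T t x) (Ici 0)

/-- `A` is the generator of the cosine family `T`: its domain consists of the `x` for which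
`2 (T(t) x - x) / t ^ 2` has a limit as `t` decreases to `0`, and `A x` is this limit. -/
def IsCosineGenerator (T : ℝ → B →L[𝕜] B) (A : B →ₗ.[𝕜] B) : Prop :=
  ∀ x y : B, (x, y) ∈ A.graph ↔
    Tendsto (fun t : ℝ => ((2 / t ^ 2 : ℝ) : 𝕜) • (T t x - x)) (𝓝[>] 0) (𝓝 y)

/-- `S` is a resolvent for the Volterra equation with operator `A` and kernel `a`. Only the values
`S t` with `0 ≤ t` matter. -/
structure IsVolterraResolvent [NormedSpace ℝ B] (A : B →ₗ.[𝕜] B) (a : ℝ → ℝ)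
    (S : ℝ → B →L[𝕜] B) : Prop where
  strongCont : ∀ x : B, ContinuousOn (fun t => S t x) (Ici 0)
  zero : S 0 = ContinuousLinearMap.id 𝕜 B
  mapsDomain : ∀ t : ℝ, 0 ≤ t → ∀ x ∈ A.domain, S t x ∈ A.domain
  commutes : ∀ t : ℝ, 0 ≤ t → ∀ x ∈ A.domain, opValue A (S t x) = S t (opValue A x)
  resolventEq : ∀ x ∈ A.domain, ∀ t : ℝ, 0 ≤ t →
    S t x = x + ∫ τ in (0 : ℝ)..t, a (t - τ) • opValue A (S τ x)

/-- `α`-times resolvent families for `A`. -/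
def IsFracResolvent [NormedSpace ℝ B] (α : ℝ) (A : B →ₗ.[𝕜] B) (S : ℝ → B →L[𝕜] B) : Prop :=
  IsVolterraResolvent A (fracKernel α) S

end

/-! The approximants are the second differences A_n = 2(T(h_n) - I)/h_n², with h_n → 0, and their
resolvent families are the Mittag-Leffler series E_α(t^α A_n). Everything rests on a resolvent
estimate for A_n that is uniform in n.

Resolvent estimate. The operators T(kh) obey the Chebyshev recursion, so Σ q^k T(kh) inverts 1 + q²
- 2qT(h) up to a scalar. Putting h²νq = (1 - q)² turns this into a formula for (ν - A_n)⁻¹, and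
‖T(kh)‖ ≤ M e^{wkh}, with w = √ω, bounds ‖ν(ν - A_n)⁻¹‖ for ν in a sector off the negative axis with
|ν| + Re ν ≥ 4ω (`norm_smul_resolvent_secondDifference_le`). For ν = μ^α both conditions follow from
Re μ > (2ω)^{1/α}, because |μ^α| + Re μ^α ≥ 2(Re μ)^α (`two_mul_re_rpow_le`).

From resolvent to family. The Laplace transform of E_α(t^α a) decays only like 1/|μ|, so t E_α(t^α
a) is used instead. Its transform is minus the derivative of μ^{α-1}(μ^α - a)⁻¹, namely μ⁻²((1 - α)W
+ αW²) with W = μ^α(μ^α - a)⁻¹; it is absolutely integrable on vertical lines when W is bounded.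
Inversion on the line Re μ = β + 1/t, where β = (2ω)^{1/α}, gives the exponential bound
(`HasResolventBound.norm_mlFamily_le`). The same integral for two commuting elements a, b contains
the factor a - b (`exists_mlFamily_sub_eq_mul`), so differences of the families at x are controlled
by ‖A_n x - A_m x‖.

Limit. On D(A), A_n x → Ax makes the families uniformly Cauchy on bounded intervals; D(A) is dense
and the bounds are uniform, so this extends to all x. The resolvent equation passes to the limit
(`isFracResolvent_of_tendsto`).

Contour integrals need complex scalars while B may be real. Operators are therefore moved by
`complexDual` to the complex Banach space of real-linear maps B → ℂ, and estimates return by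
Hahn–Banach. -/

/-! ### Mittag-Leffler series of bounded operators. -/

/-- The coefficients `t ^ (α k) / Γ(α k + 1)` of the Mittag-Leffler series. -/
noncomputable def mlCoeff (α : ℝ) (k : ℕ) (t : ℝ) : ℝ :=
  t ^ (α * k) / Real.Gamma (α * k + 1)

/-- The Mittag-Leffler family `E_α(t ^ α a)` of an element `a` of a Banach algebra. -/
noncomputable def mlFamily (𝕜 : Type*) [RCLike 𝕜] {E : Type*} [NormedRing E] [NormedAlgebra 𝕜 E]
    (α : ℝ) (a : E) (t : ℝ) : E :=
  ∑' k : ℕ, ((mlCoeff α k t : ℝ) : 𝕜) • a ^ k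

/-- Discard the part of the Gamma integral below R and use x^s ≥ R^s on the rest. This crude bound
replaces Stirling's formula. -/
theorem rpow_mul_exp_neg_le_Gamma {R s : ℝ} (hR : 0 ≤ R) (hs : 0 ≤ s) :
    R ^ s * Real.exp (-R) ≤ Real.Gamma (s + 1) := by
  rw [Real.Gamma_eq_integral (by linarith)]
  have hint := Real.GammaIntegral_convergent (s := s + 1) (by linarith)
  have hexp : MeasureTheory.IntegrableOn (fun x : ℝ => Real.exp (-x)) (Ioi R) :=
    integrableOn_exp_neg_Ioi R
  calc R ^ s * Real.exp (-R) = ∫ x in Ioi R, R ^ s * Real.exp (-x) := by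
        rw [MeasureTheory.integral_const_mul, integral_exp_neg_Ioi]
    _ ≤ ∫ x in Ioi R, Real.exp (-x) * x ^ (s + 1 - 1) := by
        refine MeasureTheory.setIntegral_mono_on (hexp.const_mul _)
          (hint.mono_set (Ioi_subset_Ioi hR)) measurableSet_Ioi fun x hx => ?_
        rw [mul_comm, add_sub_cancel_right]
        gcongr
        exact le_of_lt hx
    _ ≤ ∫ x in Ioi 0, Real.exp (-x) * x ^ (s + 1 - 1) := by
        refine MeasureTheory.setIntegral_mono_set hint ?_ (Ioi_subset_Ioi hR).eventuallyLE
        filter_upwards [MeasureTheory.self_mem_ae_restrict measurableSet_Ioi] with x hx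
        have : (0 : ℝ) < x := hx
        positivity

section coeff

variable {α : ℝ}

theorem Gamma_mul_add_one_pos (hα : 0 < α) (k : ℕ) : 0 < Real.Gamma (α * k + 1) :=
  Real.Gamma_pos_of_pos (by positivity)

theorem mlCoeff_nonneg (hα : 0 < α) (k : ℕ) {t : ℝ} (ht : 0 ≤ t) : 0 ≤ mlCoeff α k t :=
  div_nonneg (Real.rpow_nonneg ht _) (Gamma_mul_add_one_pos hα k).le

@[simp] theorem mlCoeff_zero (t : ℝ) : mlCoeff α 0 t = 1 := by
  simp [mlCoeff]

theorem mlCoeff_succ_zero (hα : 0 < α) (k : ℕ) : mlCoeff α (k + 1) 0 = 0 := by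
  rw [mlCoeff, Real.zero_rpow (by positivity), zero_div]

theorem continuous_mlCoeff (hα : 0 < α) (k : ℕ) : Continuous (mlCoeff α k) :=
  (Real.continuous_rpow_const (by positivity)).div_const _

theorem mlCoeff_mono (hα : 0 < α) (k : ℕ) {s t : ℝ} (hs : 0 ≤ s) (hst : s ≤ t) :
    mlCoeff α k s ≤ mlCoeff α k t :=
  div_le_div_of_nonneg_right (Real.rpow_le_rpow hs hst (by positivity))
    (Gamma_mul_add_one_pos hα k).le

theorem exists_mlCoeff_mul_pow_le (hα : 0 < α) {t ρ : ℝ} (ht : 0 ≤ t) (hρ : 0 ≤ ρ) :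
    ∃ K : ℝ, ∀ k : ℕ, mlCoeff α k t * ρ ^ k ≤ K * (1 / 2) ^ k := by
  have hb : 0 < 2 * (ρ + 1) * (t + 1) ^ α := by positivity
  -- R is chosen so that R^(αk) = (2(ρ + 1)(t + 1)^α)^k, which beats (t^α ρ)^k by the factor 2^k.
  set R : ℝ := (2 * (ρ + 1) * (t + 1) ^ α) ^ (1 / α) with hR
  have hRpos : 0 < R := Real.rpow_pos_of_pos hb _
  have hRα : R ^ α = 2 * (ρ + 1) * (t + 1) ^ α := by
    rw [hR, ← Real.rpow_mul hb.le, one_div_mul_cancel hα.ne', Real.rpow_one]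
  refine ⟨Real.exp R, fun k => ?_⟩
  have hG := rpow_mul_exp_neg_le_Gamma hRpos.le (s := α * k) (by positivity)
  have hpow : R ^ (α * k) = (2 * (ρ + 1) * (t + 1) ^ α) ^ k := by
    rw [Real.rpow_mul hRpos.le, hRα, Real.rpow_natCast]
  have htpow : t ^ (α * k) = (t ^ α) ^ k := by
    rw [Real.rpow_mul ht, Real.rpow_natCast]
  rw [mlCoeff, div_mul_eq_mul_div, div_le_iff₀ (Gamma_mul_add_one_pos hα k)]
  calc t ^ (α * k) * ρ ^ k = (t ^ α * ρ) ^ k := by rw [htpow, mul_pow]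
    _ ≤ ((t + 1) ^ α * (ρ + 1)) ^ k := by
        gcongr <;> linarith
    _ = Real.exp R * (1 / 2) ^ k * (R ^ (α * k) * Real.exp (-R)) := by
        rw [hpow, Real.exp_neg]
        field_simp
        rw [← mul_pow]
        congr 1
        ring
    _ ≤ Real.exp R * (1 / 2) ^ k * Real.Gamma (α * k + 1) := by
        gcongr

theorem summable_mlCoeff_mul_pow (hα : 0 < α) {t ρ : ℝ} (ht : 0 ≤ t) (hρ : 0 ≤ ρ) :
    Summable fun k : ℕ => mlCoeff α k t * ρ ^ k := by
  obtain ⟨K, hK⟩ := exists_mlCoeff_mul_pow_le hα ht hρ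
  exact Summable.of_nonneg_of_le
    (fun k => mul_nonneg (mlCoeff_nonneg hα k ht) (pow_nonneg hρ k)) hK
    ((summable_geometric_of_lt_one (by norm_num) (by norm_num)).mul_left K)

theorem intervalIntegrable_fracKernel (hα : 0 < α) (t : ℝ) :
    IntervalIntegrable (fun τ => fracKernel α (t - τ)) MeasureTheory.volume 0 t := by
  have h := (intervalIntegral.intervalIntegrable_rpow' (a := t) (b := 0) (r := α - 1)
    (by linarith)).div_const (Real.Gamma α)
  simpa [fracKernel] using h.comp_sub_left t

theorem fracKernel_nonneg (hα : 0 < α) {t : ℝ} (ht : 0 ≤ t) : 0 ≤ fracKernel α t :=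
  div_nonneg (Real.rpow_nonneg ht _) (Real.Gamma_pos_of_pos hα).le

/-- Euler's Beta integral, transported from its complex form. -/
theorem integral_fracKernel_mul_mlCoeff (hα : 0 < α) (k : ℕ) {t : ℝ} (ht : 0 ≤ t) :
    ∫ τ in (0 : ℝ)..t, fracKernel α (t - τ) * mlCoeff α k τ = mlCoeff α (k + 1) t := by
  rcases ht.eq_or_lt with rfl | ht
  · rw [intervalIntegral.integral_same, mlCoeff_succ_zero hα]
  have hk : 0 < α * k + 1 := by positivity
  have h1 := Complex.betaIntegral_scaled ((α * k + 1 : ℝ) : ℂ) (α : ℂ) ht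
  have h2 := Complex.Gamma_mul_Gamma_eq_betaIntegral (s := ((α * k + 1 : ℝ) : ℂ)) (t := (α : ℂ))
    (by simpa using hk) (by simpa using hα)
  have hG : Real.Gamma (α * (k + 1 : ℕ) + 1) ≠ 0 := (Gamma_mul_add_one_pos hα (k + 1)).ne'
  have hG' : Real.Gamma (α * k + 1) ≠ 0 := (Gamma_mul_add_one_pos hα k).ne'
  have hGα : Real.Gamma α ≠ 0 := (Real.Gamma_pos_of_pos hα).ne'
  have h3 : (∫ x in (0 : ℝ)..t, x ^ (α * k) * (t - x) ^ (α - 1)) * Real.Gamma (α * (k + 1 : ℕ) + 1)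
      = t ^ (α * (k + 1 : ℕ)) * (Real.Gamma (α * k + 1) * Real.Gamma α) := by
    have h4 : ((∫ x in (0 : ℝ)..t, x ^ (α * k) * (t - x) ^ (α - 1) : ℝ) : ℂ)
        = ∫ x in (0 : ℝ)..t, (x : ℂ) ^ (((α * k + 1 : ℝ) : ℂ) - 1) * ((t : ℂ) - x) ^ ((α : ℂ) - 1) := by
      rw [← intervalIntegral.integral_ofReal]
      refine intervalIntegral.integral_congr fun x hx => ?_
      rw [uIcc_of_le ht.le] at hx
      rw [Complex.ofReal_mul, Complex.ofReal_cpow hx.1, Complex.ofReal_cpow (sub_nonneg.2 hx.2)]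
      push_cast
      ring_nf
    have h5 : (((α * k + 1 : ℝ) : ℂ) + α) = ((α * (k + 1 : ℕ) + 1 : ℝ) : ℂ) := by
      push_cast; ring
    have h6 : (t : ℂ) ^ (((α * k + 1 : ℝ) : ℂ) + α - 1) = ((t ^ (α * (k + 1 : ℕ)) : ℝ) : ℂ) := by
      rw [h5, Complex.ofReal_cpow ht.le]
      congr 1
      push_cast; ring
    rw [h6] at h1
    rw [h5, Complex.Gamma_ofReal, Complex.Gamma_ofReal, Complex.Gamma_ofReal] at h2
    apply Complex.ofReal_injective
    rw [Complex.ofReal_mul, h4, h1, mul_assoc, mul_comm (Complex.betaIntegral _ _), ← h2]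
    push_cast
    ring
  have h7 : ∀ τ, fracKernel α (t - τ) * mlCoeff α k τ
      = (Real.Gamma α)⁻¹ * (Real.Gamma (α * k + 1))⁻¹ * (τ ^ (α * k) * (t - τ) ^ (α - 1)) := by
    intro τ
    rw [fracKernel, mlCoeff]
    ring
  simp_rw [h7]
  rw [intervalIntegral.integral_const_mul, mlCoeff, eq_div_iff hG, mul_assoc, h3]
  field_simp

end coeff

section family

variable {𝕜 : Type*} [RCLike 𝕜] {E : Type*} [NormedRing E] [NormedAlgebra 𝕜 E] {α : ℝ}

/-- The factor 1 + ‖1‖ only serves k = 0: the norm of the unit is not assumed to be 1. -/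
theorem norm_pow_le_one_add_mul {E : Type*} [NormedRing E] (a : E) (k : ℕ) :
    ‖a ^ k‖ ≤ (1 + ‖(1 : E)‖) * ‖a‖ ^ k := by
  rcases Nat.eq_zero_or_pos k with rfl | hk
  · simp
  · exact (norm_pow_le' a hk).trans (le_mul_of_one_le_left (by positivity) (by simp))

theorem norm_mlCoeff_smul_pow_le (hα : 0 < α) (a : E) (k : ℕ) {t : ℝ} (ht : 0 ≤ t) :
    ‖((mlCoeff α k t : ℝ) : 𝕜) • a ^ k‖ ≤ (1 + ‖(1 : E)‖) * (mlCoeff α k t * ‖a‖ ^ k) := by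
  rw [norm_smul, RCLike.norm_ofReal, abs_of_nonneg (mlCoeff_nonneg hα k ht), mul_left_comm]
  exact mul_le_mul_of_nonneg_left (norm_pow_le_one_add_mul a k) (mlCoeff_nonneg hα k ht)

theorem summable_norm_mlFamily (hα : 0 < α) (a : E) {t : ℝ} (ht : 0 ≤ t) :
    Summable fun k : ℕ => ‖((mlCoeff α k t : ℝ) : 𝕜) • a ^ k‖ :=
  Summable.of_nonneg_of_le (fun _ => norm_nonneg _)
    (fun k => norm_mlCoeff_smul_pow_le hα a k ht)
    ((summable_mlCoeff_mul_pow hα ht (norm_nonneg a)).mul_left _)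

theorem hasSum_mlFamily [CompleteSpace E] (hα : 0 < α) (a : E) {t : ℝ} (ht : 0 ≤ t) :
    HasSum (fun k : ℕ => ((mlCoeff α k t : ℝ) : 𝕜) • a ^ k) (mlFamily 𝕜 α a t) :=
  (summable_norm_mlFamily hα a ht).of_norm.hasSum

theorem mlFamily_zero (hα : 0 < α) (a : E) : mlFamily 𝕜 α a 0 = 1 := by
  rw [mlFamily, tsum_eq_single 0]
  · simp
  · intro k hk
    obtain ⟨m, rfl⟩ := Nat.exists_eq_succ_of_ne_zero hk
    simp [mlCoeff_succ_zero hα m]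

theorem continuousOn_mlFamily [CompleteSpace E] (hα : 0 < α) (a : E) :
    ContinuousOn (mlFamily 𝕜 α a) (Ici 0) := by
  intro t ht
  have hc : ContinuousOn (mlFamily 𝕜 α a) (Icc 0 (t + 1)) := by
    refine continuousOn_tsum
      (u := fun k => (1 + ‖(1 : E)‖) * (mlCoeff α k (t + 1) * ‖a‖ ^ k)) ?_ ?_ ?_
    · intro k
      exact ((RCLike.continuous_ofReal.comp (continuous_mlCoeff hα k)).smul
        continuous_const).continuousOn
    · exact (summable_mlCoeff_mul_pow hα (by linarith [mem_Ici.1 ht]) (norm_nonneg a)).mul_left _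
    · intro k s hs
      refine (norm_mlCoeff_smul_pow_le hα a k hs.1).trans ?_
      gcongr
      exact mlCoeff_mono hα k hs.1 hs.2
  refine (hc t ⟨ht, by linarith⟩).mono_of_mem_nhdsWithin ?_
  filter_upwards [self_mem_nhdsWithin, nhdsWithin_le_nhds (Iio_mem_nhds (lt_add_one t))] with s h1 h2
  exact ⟨h1, le_of_lt h2⟩

theorem commute_mlFamily [CompleteSpace E] (hα : 0 < α) {a b : E} (hab : Commute b a) {t : ℝ}
    (ht : 0 ≤ t) : Commute b (mlFamily 𝕜 α a t) := by
  have h := hasSum_mlFamily (𝕜 := 𝕜) hα a ht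
  refine (h.mul_left b).unique ?_
  convert h.mul_right b using 2 with k
  rw [mul_smul_comm, smul_mul_assoc, (hab.pow_right k).eq]

end family

section operators

variable {𝕜 : Type*} [RCLike 𝕜] {B : Type*} [NormedAddCommGroup B] [NormedSpace 𝕜 B]
  [NormedSpace ℝ B] [IsScalarTower ℝ 𝕜 B] [CompleteSpace B] {α : ℝ}

theorem hasSum_mlFamily_apply (hα : 0 < α) (P : B →L[𝕜] B) {t : ℝ} (ht : 0 ≤ t) (x : B) :
    HasSum (fun k : ℕ => mlCoeff α k t • (P ^ k) x) (mlFamily 𝕜 α P t x) := by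
  have h := (ContinuousLinearMap.apply 𝕜 B x).hasSum (hasSum_mlFamily (𝕜 := 𝕜) hα P ht)
  simpa [← RCLike.real_smul_eq_coe_smul (K := 𝕜)] using h

/-- Convolution with the kernel, followed by P, sends the k-th term of the series to the next one;
dominated convergence allows termwise integration. -/
theorem mlFamily_apply_eq_add_integral (hα : 0 < α) (P : B →L[𝕜] B) {t : ℝ} (ht : 0 ≤ t) (x : B) :
    mlFamily 𝕜 α P t x = x + ∫ τ in (0 : ℝ)..t, fracKernel α (t - τ) • P (mlFamily 𝕜 α P τ x) := by
  have hsum := hasSum_mlFamily_apply hα P ht x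
  have hint : HasSum (fun k : ℕ => ∫ τ in (0 : ℝ)..t,
      fracKernel α (t - τ) • mlCoeff α k τ • (P ^ (k + 1)) x)
      (∫ τ in (0 : ℝ)..t, fracKernel α (t - τ) • P (mlFamily 𝕜 α P τ x)) := by
    have hbd : Summable fun k : ℕ => mlCoeff α k t * ((1 + ‖(1 : B →L[𝕜] B)‖) * ‖P‖ ^ (k + 1) * ‖x‖) := by
      refine ((summable_mlCoeff_mul_pow hα ht (norm_nonneg P)).mul_left
        ((1 + ‖(1 : B →L[𝕜] B)‖) * ‖P‖ * ‖x‖)).congr fun k => ?_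
      ring
    refine intervalIntegral.hasSum_integral_of_dominated_convergence
      (fun k τ => fracKernel α (t - τ) *
        (mlCoeff α k t * ((1 + ‖(1 : B →L[𝕜] B)‖) * ‖P‖ ^ (k + 1) * ‖x‖))) ?_ ?_ ?_ ?_ ?_
    · intro k
      have h1 := (intervalIntegrable_fracKernel hα t).aestronglyMeasurable
      rw [uIoc_of_le ht]
      exact h1.smul ((continuous_mlCoeff hα k).smul continuous_const).aestronglyMeasurable
    · intro k
      refine Eventually.of_forall fun τ hτ => ?_
      rw [uIoc_of_le ht] at hτ
      rw [norm_smul, norm_smul, Real.norm_of_nonneg (fracKernel_nonneg hα (sub_nonneg.2 hτ.2)),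
        Real.norm_of_nonneg (mlCoeff_nonneg hα k hτ.1.le)]
      have := fracKernel_nonneg hα (sub_nonneg.2 hτ.2)
      have := mlCoeff_mono hα k hτ.1.le hτ.2
      have := mlCoeff_nonneg hα k hτ.1.le
      gcongr
      · linarith
      exact ((P ^ (k + 1)).le_opNorm x).trans
        (mul_le_mul_of_nonneg_right (norm_pow_le_one_add_mul P (k + 1)) (norm_nonneg x))
    · exact Eventually.of_forall fun τ _ => hbd.mul_left _
    · simp_rw [tsum_mul_left]
      exact (intervalIntegrable_fracKernel hα t).mul_const _
    · refine Eventually.of_forall fun τ hτ => ?_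
      rw [uIoc_of_le ht] at hτ
      have h1 := (hasSum_mlFamily_apply hα P hτ.1.le x).mapL (P.restrictScalars ℝ)
      have h2 := h1.const_smul (fracKernel α (t - τ))
      simpa [pow_succ'] using h2
  have hterm : ∀ k : ℕ, ∫ τ in (0 : ℝ)..t, fracKernel α (t - τ) • mlCoeff α k τ • (P ^ (k + 1)) x
      = mlCoeff α (k + 1) t • (P ^ (k + 1)) x := by
    intro k
    simp_rw [smul_smul]
    rw [intervalIntegral.integral_smul_const, integral_fracKernel_mul_mlCoeff hα k ht]
  simp_rw [hterm] at hint
  have h2 := (hasSum_nat_add_iff' 1).2 hsum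
  have h3 := hint.unique h2
  rw [h3]
  simp

theorem opValue_boundedOp {𝕜 : Type*} [RCLike 𝕜] {B : Type*} [NormedAddCommGroup B]
    [NormedSpace 𝕜 B] (P : B →L[𝕜] B) (x : B) : opValue (boundedOp P) x = P x := by
  have h : x ∈ (boundedOp P).domain := Submodule.mem_top
  rw [opValue, dif_pos h]
  rfl

theorem isFracResolvent_mlFamily (hα : 0 < α) (P : B →L[𝕜] B) :
    IsFracResolvent α (boundedOp P) (mlFamily 𝕜 α P) where
  strongCont x := (continuousOn_mlFamily hα P).clm_apply continuousOn_const
  zero := mlFamily_zero hα P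
  mapsDomain _ _ _ _ := Submodule.mem_top
  commutes t ht x _ := by
    rw [opValue_boundedOp, opValue_boundedOp]
    exact congrArg (fun Q : B →L[𝕜] B => Q x) (commute_mlFamily hα (Commute.refl P) ht).eq
  resolventEq x _ t ht := by
    simp_rw [opValue_boundedOp]
    exact mlFamily_apply_eq_add_integral hα P ht x

end operators

/-! ### Laplace transforms of powers, their inversion, and shifts of vertical lines. -/

open MeasureTheory in
theorem differentiableOn_integral_rpow_mul_cexp {r : ℝ} (hr : 0 < r) :
    DifferentiableOn ℂ
      (fun z : ℂ => ∫ v in Ioi (0 : ℝ), ((v ^ (r - 1) : ℝ) : ℂ) * Complex.exp (-(z * v)))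
      {z | 0 < z.re} := by
  intro z₀ hz₀
  have hz₀' : 0 < z₀.re := hz₀
  have hmeas : ∀ z : ℂ, AEStronglyMeasurable
      (fun v : ℝ => ((v ^ (r - 1) : ℝ) : ℂ) * Complex.exp (-(z * v))) (volume.restrict (Ioi 0)) := by
    intro z
    refine Measurable.aestronglyMeasurable ?_
    fun_prop
  have hnorm : ∀ (z : ℂ) (v : ℝ), 0 < v →
      ‖((v ^ (r - 1) : ℝ) : ℂ) * Complex.exp (-(z * v))‖ = v ^ (r - 1) * Real.exp (-(z.re * v)) := by
    intro z v hv
    rw [norm_mul, Complex.norm_real, Real.norm_of_nonneg (by positivity), Complex.norm_exp]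
    simp
  have key := hasDerivAt_integral_of_dominated_loc_of_deriv_le (𝕜 := ℂ)
    (μ := volume.restrict (Ioi (0 : ℝ)))
    (F := fun (z : ℂ) (v : ℝ) => ((v ^ (r - 1) : ℝ) : ℂ) * Complex.exp (-(z * v)))
    (F' := fun (z : ℂ) (v : ℝ) => ((v ^ (r - 1) : ℝ) : ℂ) * (Complex.exp (-(z * v)) * (-v)))
    (x₀ := z₀) (s := Metric.ball z₀ (z₀.re / 2))
    (bound := fun v => v ^ r * Real.exp (-(z₀.re / 2) * v))
    (Metric.ball_mem_nhds z₀ (by linarith)) ?_ ?_ ?_ ?_ ?_ ?_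
  · exact key.2.differentiableAt.differentiableWithinAt
  · exact Eventually.of_forall hmeas
  · refine Integrable.mono' (g := fun v : ℝ => v ^ (r - 1) * Real.exp (-(z₀.re) * v)) ?_ (hmeas _) ?_
    · have := integrableOn_rpow_mul_exp_neg_mul_rpow (s := r - 1) (p := 1) (b := z₀.re)
        (by linarith) (by norm_num) hz₀'
      simpa [IntegrableOn] using this
    · filter_upwards [ae_restrict_mem measurableSet_Ioi] with v hv
      rw [hnorm _ _ hv, neg_mul]
  · refine Measurable.aestronglyMeasurable ?_
    fun_prop
  · filter_upwards [ae_restrict_mem measurableSet_Ioi] with v hv z hz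
    have hv' : (0 : ℝ) < v := hv
    have h1 : z₀.re / 2 ≤ z.re := by
      have h2 := (Complex.abs_re_le_norm (z - z₀)).trans (mem_ball_iff_norm.1 hz).le
      have := (abs_le.1 h2).1
      rw [Complex.sub_re] at this
      linarith
    rw [← mul_assoc, norm_mul, hnorm _ _ hv', norm_neg, Complex.norm_real,
      Real.norm_of_nonneg hv'.le, mul_right_comm]
    have h3 : v ^ (r - 1) * v = v ^ r := by
      rw [← Real.rpow_add_one hv'.ne', sub_add_cancel]
    rw [h3]
    gcongr
    nlinarith
  · have := integrableOn_rpow_mul_exp_neg_mul_rpow (s := r) (p := 1) (b := z₀.re / 2)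
      (by linarith) (by norm_num) (by linarith)
    simpa [IntegrableOn] using this
  · refine Eventually.of_forall fun v z _ => ?_
    have h1 : HasDerivAt (fun z : ℂ => -(z * v)) (-v : ℂ) z := by
      simpa using ((hasDerivAt_id' z).mul_const (v : ℂ)).fun_neg
    exact h1.cexp.const_mul _

/-- The Laplace transform of `v ^ (r - 1)` at a complex argument. -/
theorem integral_rpow_mul_cexp_neg_mul {r : ℝ} (hr : 0 < r) {z : ℂ} (hz : 0 < z.re) :
    ∫ v in Ioi (0 : ℝ), ((v ^ (r - 1) : ℝ) : ℂ) * Complex.exp (-(z * v))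
      = Real.Gamma r * z ^ (-(r : ℂ)) := by
  have hopen : IsOpen {z : ℂ | 0 < z.re} := isOpen_lt continuous_const Complex.continuous_re
  have hconv : IsPreconnected {z : ℂ | 0 < z.re} := (convex_halfSpace_re_gt 0).isPreconnected
  have hf := (differentiableOn_integral_rpow_mul_cexp hr).analyticOnNhd hopen
  have hg : AnalyticOnNhd ℂ (fun z : ℂ => Real.Gamma r * z ^ (-(r : ℂ))) {z | 0 < z.re} := by
    refine DifferentiableOn.analyticOnNhd (fun w hw => ?_) hopen
    exact ((differentiableAt_id.cpow (differentiableAt_const _)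
      (Or.inl hw)).const_mul _).differentiableWithinAt
  -- Both sides are holomorphic on the right half-plane and agree at real points accumulating at 1,
  -- so the identity theorem applies.
  refine hf.eqOn_of_preconnected_of_frequently_eq hg hconv (z₀ := 1) (by simp) ?_ hz
  have hreal : ∀ s : ℝ, 0 < s →
      ∫ v in Ioi (0 : ℝ), ((v ^ (r - 1) : ℝ) : ℂ) * Complex.exp (-((s : ℂ) * v))
        = Real.Gamma r * (s : ℂ) ^ (-(r : ℂ)) := by
    intro s hs
    have h := Real.integral_rpow_mul_exp_neg_mul_Ioi hr hs
    have h2 : ∀ v : ℝ, ((v ^ (r - 1) : ℝ) : ℂ) * Complex.exp (-((s : ℂ) * v))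
        = ((v ^ (r - 1) * Real.exp (-(s * v)) : ℝ) : ℂ) := by
      intro v; push_cast; rfl
    simp_rw [h2]
    rw [integral_complex_ofReal, h, ← Complex.ofReal_neg, ← Complex.ofReal_cpow hs.le, ← Complex.ofReal_mul,
      one_div, Real.inv_rpow hs.le, Real.rpow_neg hs.le, mul_comm]
  have htend : Tendsto (fun s : ℝ => (s : ℂ)) (𝓝[>] 1) (𝓝[≠] 1) := by
    refine tendsto_nhdsWithin_iff.2 ⟨?_, ?_⟩
    · exact (Complex.continuous_ofReal.tendsto' 1 1 (by simp)).mono_left nhdsWithin_le_nhds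
    · filter_upwards [self_mem_nhdsWithin] with s hs
      simpa using (ne_of_gt hs)
  refine htend.frequently (Eventually.frequently ?_)
  filter_upwards [self_mem_nhdsWithin] with s hs
  exact hreal s (lt_trans one_pos hs)

section lines

theorem norm_add_mul_I_sq (c y : ℝ) : ‖(c + y * Complex.I : ℂ)‖ ^ 2 = c ^ 2 + y ^ 2 := by
  rw [Complex.norm_add_mul_I, Real.sq_sqrt (by positivity)]

theorem le_norm_add_mul_I (c y : ℝ) : c ≤ ‖(c + y * Complex.I : ℂ)‖ :=
  (le_abs_self c).trans (by simpa using Complex.abs_re_le_norm (c + y * Complex.I : ℂ))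

theorem integrable_norm_add_mul_I_inv_sq {c : ℝ} (hc : 0 < c) :
    MeasureTheory.Integrable fun y : ℝ => (‖(c + y * Complex.I : ℂ)‖ ^ 2)⁻¹ := by
  have h := (integrable_inv_one_add_sq.comp_div hc.ne').const_mul (c ^ 2)⁻¹
  refine h.congr (Eventually.of_forall fun y => ?_)
  simp only
  rw [norm_add_mul_I_sq, ← mul_inv]
  congr 1
  field_simp

theorem integral_norm_add_mul_I_inv_sq {c : ℝ} (hc : 0 < c) :
    ∫ y : ℝ, (‖(c + y * Complex.I : ℂ)‖ ^ 2)⁻¹ = Real.pi / c := by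
  have h : ∀ y : ℝ, (‖(c + y * Complex.I : ℂ)‖ ^ 2)⁻¹ = (c ^ 2)⁻¹ * (1 + (y / c) ^ 2)⁻¹ := by
    intro y
    rw [norm_add_mul_I_sq, ← mul_inv]
    congr 1
    field_simp
  simp_rw [h]
  rw [MeasureTheory.integral_const_mul,
    MeasureTheory.Measure.integral_comp_div (fun y => (1 + y ^ 2)⁻¹) c, integral_univ_inv_one_add_sq,
    abs_of_pos hc, smul_eq_mul]
  field_simp

theorem norm_cexp_line (c y t : ℝ) :
    ‖Complex.exp ((c + y * Complex.I) * t)‖ = Real.exp (c * t) := by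
  rw [Complex.norm_exp]
  simp

theorem add_mul_I_mem_slitPlane {c : ℝ} (hc : 0 < c) (y : ℝ) :
    (c + y * Complex.I : ℂ) ∈ Complex.slitPlane :=
  Or.inl (by simpa using hc)

theorem continuous_line_cpow {c : ℝ} (hc : 0 < c) (s : ℂ) :
    Continuous fun y : ℝ => (c + y * Complex.I : ℂ) ^ s :=
  Continuous.cpow (by fun_prop) continuous_const fun y => add_mul_I_mem_slitPlane hc y

/-- A function on a vertical line of norm at most a multiple of `1 / |μ| ^ 2` is integrable. -/
theorem integrable_line_of_norm_le {E : Type*} [NormedAddCommGroup E] {c C : ℝ} (hc : 0 < c)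
    {F : ℝ → E} (hF : Continuous F)
    (hb : ∀ y : ℝ, ‖F y‖ ≤ C * (‖(c + y * Complex.I : ℂ)‖ ^ 2)⁻¹) :
    MeasureTheory.Integrable F :=
  ((integrable_norm_add_mul_I_inv_sq hc).const_mul C).mono' hF.aestronglyMeasurable
    (Eventually.of_forall hb)

theorem norm_line_cpow_neg_le {c r : ℝ} (hc : 0 < c) (hr : 2 ≤ r) (y : ℝ) :
    ‖(c + y * Complex.I : ℂ) ^ (-(r : ℂ))‖
      ≤ c ^ (-(r - 2)) * (‖(c + y * Complex.I : ℂ)‖ ^ 2)⁻¹ := by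
  have h := le_norm_add_mul_I c y
  have hpos : 0 < ‖(c + y * Complex.I : ℂ)‖ := hc.trans_le h
  rw [← Complex.ofReal_neg, Complex.norm_cpow_real, show -r = -(r - 2) + -(2 : ℕ) by push_cast; ring,
    Real.rpow_add hpos, Real.rpow_neg hpos.le (2 : ℕ), Real.rpow_natCast]
  exact mul_le_mul_of_nonneg_right (Real.rpow_le_rpow_of_nonpos hc h (by linarith)) (by positivity)

open MeasureTheory FourierTransform in
/-- Inversion of the Laplace transform of a power. -/
theorem integral_line_cexp_mul_cpow {r c t : ℝ} (hr : 2 ≤ r) (hc : 0 < c) (ht : 0 < t) :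
    ∫ y : ℝ, Complex.exp ((c + y * Complex.I) * t) * (c + y * Complex.I : ℂ) ^ (-(r : ℂ))
      = ((2 * Real.pi * (t ^ (r - 1) / Real.Gamma r) : ℝ) : ℂ) := by
  -- The Fourier transform of this f is Γ(r)(c + 2πiw)^(-r), so Fourier inversion at t is the claim
  -- after rescaling w by 2π. Integrability on the line is where r ≥ 2 enters.
  set f : ℝ → ℂ := (Ioi (0 : ℝ)).indicator
    (fun v => ((v ^ (r - 1) * Real.exp (-c * v) : ℝ) : ℂ)) with hf
  have hint : Integrable f := by
    rw [hf, integrable_indicator_iff measurableSet_Ioi]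
    have := integrableOn_rpow_mul_exp_neg_mul_rpow (s := r - 1) (p := 1) (b := c)
      (by linarith) (by norm_num) hc
    simp only [Real.rpow_one] at this
    exact Integrable.ofReal this
  have hfour : 𝓕 f = fun w : ℝ => (Real.Gamma r : ℂ) *
      (c + (2 * Real.pi * w : ℝ) * Complex.I : ℂ) ^ (-(r : ℂ)) := by
    ext w
    rw [Real.fourier_real_eq_integral_exp_smul, ← integral_rpow_mul_cexp_neg_mul (by linarith)
      (by simpa using hc), ← integral_indicator measurableSet_Ioi]
    refine integral_congr_ae (Eventually.of_forall fun v => ?_)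
    simp only [hf, indicator_apply, smul_eq_mul]
    split_ifs
    · push_cast
      rw [mul_left_comm, ← Complex.exp_add]
      congr 2
      ring
    · simp
  have hcont : Continuous fun w : ℝ => (c + (2 * Real.pi * w : ℝ) * Complex.I : ℂ) ^ (-(r : ℂ)) :=
    (continuous_line_cpow hc (-(r : ℂ))).comp (by fun_prop)
  have hbase : Integrable fun y : ℝ => (c + y * Complex.I : ℂ) ^ (-(r : ℂ)) :=
    integrable_line_of_norm_le hc (continuous_line_cpow hc _) (norm_line_cpow_neg_le hc hr)
  have hfi : Integrable (𝓕 f) := by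
    rw [hfour]
    exact (hbase.comp_mul_left' (by positivity : 2 * Real.pi ≠ 0)).const_mul _
  have hca : ContinuousAt f t := by
    have h1 : ContinuousAt (fun v : ℝ => ((v ^ (r - 1) * Real.exp (-c * v) : ℝ) : ℂ)) t := by
      refine Complex.continuous_ofReal.continuousAt.comp ?_
      exact (Real.continuousAt_rpow_const t (r - 1) (Or.inl ht.ne')).mul (by fun_prop)
    refine h1.congr ?_
    filter_upwards [Ioi_mem_nhds ht] with v hv
    rw [hf, indicator_of_mem hv]
  have hinv := hint.fourierInv_fourier_eq hfi hca
  rw [Real.fourierInv_eq', hfour, hf, indicator_of_mem (mem_Ioi.2 ht)] at hinv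
  have hG : (Real.Gamma r : ℂ) ≠ 0 := by
    exact_mod_cast (Real.Gamma_pos_of_pos (by linarith)).ne'
  have hsub := Measure.integral_comp_mul_left (fun y : ℝ =>
    Complex.exp ((c + y * Complex.I) * t) * (c + y * Complex.I : ℂ) ^ (-(r : ℂ))) (2 * Real.pi)
  have heq : ∫ w : ℝ, Complex.exp ((c + (2 * Real.pi * w : ℝ) * Complex.I) * t) *
      (c + (2 * Real.pi * w : ℝ) * Complex.I : ℂ) ^ (-(r : ℂ))
      = ((t ^ (r - 1) / Real.Gamma r : ℝ) : ℂ) := by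
    have h2 : ∀ w : ℝ, Complex.exp ((c + (2 * Real.pi * w : ℝ) * Complex.I) * t) *
      (c + (2 * Real.pi * w : ℝ) * Complex.I : ℂ) ^ (-(r : ℂ))
      = (Complex.exp (c * t) / Real.Gamma r) * (Complex.exp (((2 * Real.pi * inner ℝ w t : ℝ) : ℂ) *
        Complex.I) • ((Real.Gamma r : ℂ) *
          (c + (2 * Real.pi * w : ℝ) * Complex.I : ℂ) ^ (-(r : ℂ)))) := by
      intro w
      have h3 : Complex.exp ((c + (2 * Real.pi * w : ℝ) * Complex.I) * t)
          = Complex.exp (c * t) * Complex.exp (((2 * Real.pi * inner ℝ w t : ℝ) : ℂ) * Complex.I) := by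
        rw [← Complex.exp_add]
        congr 1
        simp
        ring
      rw [h3, smul_eq_mul]
      field_simp
    simp_rw [h2]
    rw [integral_const_mul, hinv]
    push_cast
    rw [div_mul_eq_mul_div, mul_left_comm, ← Complex.exp_add]
    simp
  rw [heq] at hsub
  rw [abs_of_pos (by positivity), Complex.real_smul] at hsub
  have hpi : ((2 * Real.pi : ℝ) : ℂ) ≠ 0 := by
    exact_mod_cast (by positivity : (2 * Real.pi : ℝ) ≠ 0)
  rw [Complex.ofReal_mul (2 * Real.pi), hsub, Complex.ofReal_inv, mul_inv_cancel_left₀ hpi]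

/-- Integrals along vertical lines do not depend on the line. -/
theorem integral_line_eq_of_norm_le {E : Type*} [NormedAddCommGroup E] [NormedSpace ℂ E]
    [CompleteSpace E] {F : ℂ → E} {β c₁ c₂ C : ℝ} (hβ : 0 ≤ β) (h₁ : β < c₁) (h₁₂ : c₁ ≤ c₂)
    (hF : DifferentiableOn ℂ F {z | β < z.re})
    (hb : ∀ z : ℂ, c₁ ≤ z.re → z.re ≤ c₂ → ‖F z‖ ≤ C * (‖z‖ ^ 2)⁻¹) :
    ∫ y : ℝ, F (c₁ + y * Complex.I) = ∫ y : ℝ, F (c₂ + y * Complex.I) := by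
  have hc₁ : 0 < c₁ := hβ.trans_lt h₁
  have hcont : ∀ c : ℝ, c₁ ≤ c → Continuous fun y : ℝ => F (c + y * Complex.I) := by
    intro c hc
    refine hF.continuousOn.comp_continuous (by fun_prop) fun y => ?_
    simpa using h₁.trans_le hc
  have hint : ∀ c : ℝ, c₁ ≤ c → c ≤ c₂ →
      MeasureTheory.Integrable fun y : ℝ => F (c + y * Complex.I) := fun c hc hc' =>
    integrable_line_of_norm_le (hc₁.trans_le hc) (hcont c hc) fun y =>
      hb _ (by simpa using hc) (by simpa using hc')
  have hlim : ∀ c : ℝ, c₁ ≤ c → c ≤ c₂ →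
      Tendsto (fun R : ℝ => ∫ y in (-R)..R, F (c + y * Complex.I)) atTop
        (𝓝 (∫ y : ℝ, F (c + y * Complex.I))) := fun c hc hc' =>
    MeasureTheory.intervalIntegral_tendsto_integral (hint c hc hc') tendsto_neg_atTop_atBot tendsto_id
  have hC : 0 ≤ C := by
    have h := (norm_nonneg _).trans (hb c₁ (by simp) (by simpa using h₁₂))
    exact nonneg_of_mul_nonneg_left h (by
      have : ‖(c₁ : ℂ)‖ ≠ 0 := by simpa using hc₁.ne'
      positivity)
  -- The values ε = ±1 are the two horizontal sides of the rectangle, where the integrand is O(R⁻²).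
  have hhor : ∀ ε : ℝ, |ε| = 1 → Tendsto
      (fun R : ℝ => ∫ x in c₁..c₂, F (x + (ε * R : ℝ) * Complex.I)) atTop (𝓝 0) := by
    intro ε hε
    refine squeeze_zero_norm' (a := fun R : ℝ => C * (R ^ 2)⁻¹ * |c₂ - c₁|) ?_ ?_
    · filter_upwards [eventually_gt_atTop 0] with R hR
      refine intervalIntegral.norm_integral_le_of_norm_le_const fun x hx => ?_
      rw [uIoc_of_le h₁₂] at hx
      refine (hb _ (by simpa using hx.1.le) (by simpa using hx.2)).trans ?_
      have hsq : R ^ 2 ≤ ‖(x + (ε * R : ℝ) * Complex.I : ℂ)‖ ^ 2 := by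
        rw [norm_add_mul_I_sq, mul_pow, ← sq_abs ε, hε]
        nlinarith [sq_nonneg x]
      gcongr
    · have h := (tendsto_inv_atTop_zero.comp (tendsto_pow_atTop (α := ℝ) two_ne_zero))
      simpa using (h.const_mul C).mul_const |c₂ - c₁|
  have hrect : ∀ R : ℝ, 0 < R →
      (∫ x in c₁..c₂, F (x + ((-1) * R : ℝ) * Complex.I)) -
        (∫ x in c₁..c₂, F (x + (1 * R : ℝ) * Complex.I)) +
        Complex.I • (∫ y in (-R)..R, F (c₂ + y * Complex.I)) -
        Complex.I • (∫ y in (-R)..R, F (c₁ + y * Complex.I)) = 0 := by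
    intro R hR
    have h := Complex.integral_boundary_rect_eq_zero_of_differentiableOn F
      (c₁ + (-R : ℝ) * Complex.I) (c₂ + R * Complex.I) (hF.mono ?_)
    · simpa using h
    · intro z hz
      have h2 := hz.1
      simp only [mem_preimage] at h2
      simp at h2
      rw [uIcc_of_le h₁₂] at h2
      exact h₁.trans_le h2.1
  have hl := (((hhor (-1) (by simp)).sub (hhor 1 (by simp))).add
    ((hlim c₂ h₁₂ le_rfl).const_smul Complex.I)).sub ((hlim c₁ le_rfl h₁₂).const_smul Complex.I)
  have h0 := tendsto_nhds_unique (hl.congr' (by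
    filter_upwards [eventually_gt_atTop 0] with R hR using hrect R hR)) tendsto_const_nhds
  rw [sub_zero, zero_add, ← smul_sub, smul_eq_zero, sub_eq_zero] at h0
  exact (h0.resolve_left Complex.I_ne_zero).symm

end lines

/-! ### The Laplace transform of t E_α(t^α a) in terms of the resolvent. -/

section kernel

variable {E : Type*} [NormedRing E] [NormedAlgebra ℂ E] {α : ℝ}

/-- The operator `μ ^ α (μ ^ α - a)⁻¹`. -/
noncomputable def scaledResolvent (α : ℝ) (a : E) (μ : ℂ) : E :=
  (μ ^ (α : ℂ)) • resolvent a (μ ^ (α : ℂ))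

/-- The Laplace transform of `t E_α(t ^ α a)`. -/
noncomputable def mlKernel (α : ℝ) (a : E) (μ : ℂ) : E :=
  (μ ^ 2)⁻¹ • ((1 - α : ℂ) • scaledResolvent α a μ + (α : ℂ) • scaledResolvent α a μ ^ 2)

/-- The element `a` satisfies a resolvent estimate at the points `μ ^ α`, where `β < re μ`. -/
def HasResolventBound (α β C : ℝ) (a : E) : Prop :=
  ∀ μ : ℂ, β < μ.re → μ ^ (α : ℂ) ∈ resolventSet ℂ a ∧ ‖scaledResolvent α a μ‖ ≤ C

theorem scaledResolvent_eq_inverse (a : E) {μ : ℂ} (hμ : μ ≠ 0) :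
    scaledResolvent α a μ = Ring.inverse (1 - (μ ^ (α : ℂ))⁻¹ • a) := by
  have h0 : μ ^ (α : ℂ) ≠ 0 := by simp [Complex.cpow_eq_zero_iff, hμ]
  have h := spectrum.units_smul_resolvent_self (r := Units.mk0 _ h0) (a := a)
  simpa [Units.smul_def, resolvent, scaledResolvent] using h

theorem hasSum_mlKernel [CompleteSpace E] (a : E) {μ : ℂ} (hμ : μ ≠ 0)
    (ha : ‖a‖ < ‖μ‖ ^ α) :
    HasSum (fun k : ℕ => ((α * k + 1 : ℝ) : ℂ) • μ ^ (-((α * k + 2 : ℝ) : ℂ)) • a ^ k)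
      (mlKernel α a μ) := by
  set z : E := (μ ^ (α : ℂ))⁻¹ • a with hz
  have hpos : 0 < ‖μ‖ ^ α := (norm_nonneg a).trans_lt ha
  have hz1 : ‖z‖ < 1 := by
    rw [hz, norm_smul, norm_inv, Complex.norm_cpow_real, inv_mul_lt_iff₀ hpos, mul_one]
    exact ha
  have h1 := hasSum_geom_series_inverse z hz1
  have h2 := hasSum_choose_mul_geometric_of_norm_lt_one' 1 hz1
  have h3 := ((h1.const_smul (1 - α : ℂ)).add (h2.const_smul (α : ℂ))).const_smul (μ ^ 2)⁻¹
  rw [mlKernel, scaledResolvent_eq_inverse a hμ, ← hz]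
  -- With z = μ^(-α) a, the series of (1 - z)⁻¹ and (1 - z)⁻² have coefficients 1 and k + 1, and (1
  -- - α) + α(k + 1) = αk + 1.
  refine h3.congr_fun fun k => ?_
  have hp : μ ^ (-((α * k + 2 : ℝ) : ℂ)) = (μ ^ 2)⁻¹ * ((μ ^ (α : ℂ))⁻¹) ^ k := by
    rw [Complex.cpow_neg, Complex.ofReal_add, Complex.cpow_add _ _ hμ, mul_inv, mul_comm]
    congr 1
    · norm_num
    · rw [inv_pow, ← Complex.cpow_mul_nat]
      push_cast
      rfl
  have hn : ((k + 1).choose 1 : E) = ((k + 1 : ℂ)) • (1 : E) := by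
    rw [Nat.choose_one_right, ← map_natCast (algebraMap ℂ E), Algebra.algebraMap_eq_smul_one]
    push_cast
    rfl
  rw [hp, hn, smul_mul_assoc, one_mul, hz, smul_pow]
  simp only [smul_smul, ← add_smul]
  congr 1
  push_cast
  ring

theorem scaledResolvent_sub [CompleteSpace E] {a b : E} (hab : Commute a b) {μ : ℂ} (hμ : μ ≠ 0)
    (ha : μ ^ (α : ℂ) ∈ resolventSet ℂ a) (hb : μ ^ (α : ℂ) ∈ resolventSet ℂ b) :
    scaledResolvent α a μ - scaledResolvent α b μ
      = (μ ^ (α : ℂ))⁻¹ • ((a - b) * (scaledResolvent α a μ * scaledResolvent α b μ)) := by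
  have h0 : μ ^ (α : ℂ) ≠ 0 := by simp [Complex.cpow_eq_zero_iff, hμ]
  have hc : Commute (resolvent a (μ ^ (α : ℂ))) (a - b) := by
    have h1 : Commute (algebraMap ℂ E (μ ^ (α : ℂ)) - a) (a - b) :=
      Commute.sub_left (Algebra.commutes _ _) ((Commute.refl a).sub_right hab)
    rw [spectrum.resolvent_eq ha]
    exact Commute.units_inv_left (a := a - b) (u := ha.unit) h1
  rw [scaledResolvent, scaledResolvent, ← smul_sub, spectrum.resolvent_sub_resolvent ha hb, hc.eq]
  simp only [smul_mul_assoc, mul_smul_comm, smul_smul, mul_assoc]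
  congr 1
  field_simp

theorem commute_scaledResolvent {a b : E} (hab : Commute a b) {μ : ℂ} :
    Commute (scaledResolvent α a μ) (scaledResolvent α b μ) := by
  refine ((Commute.ringInverse_ringInverse ?_).smul_left _).smul_right _
  exact ((Algebra.commute_algebraMap_left _ _).sub_left
    ((Algebra.commute_algebraMap_right _ _).sub_right hab))

/-- The resolvent identity gives the factor a - b together with an extra μ^(-α); the squares are
handled as a difference of commuting squares. -/
theorem mlKernel_sub [CompleteSpace E] {a b : E} (hab : Commute a b) {μ : ℂ} (hμ : μ ≠ 0)
    (ha : μ ^ (α : ℂ) ∈ resolventSet ℂ a) (hb : μ ^ (α : ℂ) ∈ resolventSet ℂ b) :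
    mlKernel α a μ - mlKernel α b μ = (a - b) * ((μ ^ 2)⁻¹ • (μ ^ (α : ℂ))⁻¹ •
      ((1 - α : ℂ) • (scaledResolvent α a μ * scaledResolvent α b μ) +
        (α : ℂ) • ((scaledResolvent α a μ * scaledResolvent α b μ) *
          (scaledResolvent α a μ + scaledResolvent α b μ)))) := by
  have h := scaledResolvent_sub hab hμ ha hb
  have hW := commute_scaledResolvent (α := α) hab (μ := μ)
  have hsq : scaledResolvent α a μ ^ 2 - scaledResolvent α b μ ^ 2
      = (scaledResolvent α a μ - scaledResolvent α b μ) *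
        (scaledResolvent α a μ + scaledResolvent α b μ) := by
    rw [hW.sq_sub_sq]
    exact ((Commute.refl _).sub_right hW).add_left (hW.symm.sub_right (Commute.refl _))
  rw [mlKernel, mlKernel, ← smul_sub, add_sub_add_comm, ← smul_sub, ← smul_sub, hsq, h]
  simp only [smul_mul_assoc, mul_smul_comm, smul_add, mul_add, smul_smul, mul_assoc]
  ring_nf

end kernel

/-! ### Bounds on Mittag-Leffler families by contour integrals. -/

section bounds

variable {E : Type*} [NormedRing E] [NormedAlgebra ℂ E] {α β C : ℝ}

theorem HasResolventBound.nonneg {a : E} (h : HasResolventBound α β C a) : 0 ≤ C :=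
  (norm_nonneg _).trans (h ((β + 1 : ℝ) : ℂ) (by simp)).2

theorem HasResolventBound.norm_mlKernel_le {a : E} (h : HasResolventBound α β C a) {μ : ℂ}
    (hμ : β < μ.re) : ‖mlKernel α a μ‖ ≤ (|1 - α| * C + |α| * C ^ 2) * (‖μ‖ ^ 2)⁻¹ := by
  have h1 := (h μ hμ).2
  have hC := h.nonneg
  rw [mlKernel, norm_smul, norm_inv, norm_pow, mul_comm]
  refine mul_le_mul_of_nonneg_right ((norm_add_le _ _).trans ?_) (by positivity)
  rw [norm_smul, norm_smul, ← Complex.ofReal_one, ← Complex.ofReal_sub, Complex.norm_real,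
    Complex.norm_real, Real.norm_eq_abs, Real.norm_eq_abs]
  gcongr
  exact (norm_pow_le' _ two_pos).trans (by gcongr)

/-- The integral of |μ|⁻² over the line is π/c, which ct ≥ 1 makes at most 2πt. -/
theorem norm_le_of_norm_integral_line_le {F : ℝ → E} {S : E} {K c t : ℝ} (hc : 0 < c) (ht : 0 < t)
    (hct : 1 ≤ c * t) (hK : 0 ≤ K)
    (hS : ∫ y : ℝ, F y = ((2 * Real.pi * t : ℝ) : ℂ) • S)
    (hF : ∀ y : ℝ, ‖F y‖ ≤ K * (‖(c + y * Complex.I : ℂ)‖ ^ 2)⁻¹) : ‖S‖ ≤ K := by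
  have h1 : ‖∫ y : ℝ, F y‖ ≤ K * (Real.pi / c) := by
    rw [← integral_norm_add_mul_I_inv_sq hc, ← MeasureTheory.integral_const_mul]
    exact MeasureTheory.norm_integral_le_of_norm_le
      ((integrable_norm_add_mul_I_inv_sq hc).const_mul K) (Eventually.of_forall hF)
  have hpi := Real.pi_pos
  rw [hS, norm_smul, Complex.norm_real, Real.norm_of_nonneg (by positivity)] at h1
  have h2 : Real.pi / c ≤ 2 * Real.pi * t := by
    rw [div_le_iff₀ hc]
    nlinarith
  have h3 : 2 * Real.pi * t * ‖S‖ ≤ 2 * Real.pi * t * K := by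
    rw [mul_comm (2 * Real.pi * t) K]
    exact h1.trans (mul_le_mul_of_nonneg_left h2 hK)
  exact le_of_mul_le_mul_left h3 (by positivity)

theorem HasResolventBound.norm_integrand_le {a : E} (h : HasResolventBound α β C a) {μ : ℂ}
    (hμ : β < μ.re) {c t : ℝ} (ht : 0 ≤ t) (hc : μ.re ≤ c) :
    ‖Complex.exp (μ * t) • mlKernel α a μ‖
      ≤ (Real.exp (c * t) * (|1 - α| * C + |α| * C ^ 2)) * (‖μ‖ ^ 2)⁻¹ := by
  have hC := h.nonneg
  rw [norm_smul, mul_assoc, Complex.norm_exp]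
  refine mul_le_mul (Real.exp_le_exp.2 ?_) (h.norm_mlKernel_le hμ) (norm_nonneg _)
    (Real.exp_pos _).le
  simp only [Complex.mul_re, Complex.ofReal_re, Complex.ofReal_im, mul_zero, sub_zero]
  gcongr

variable [CompleteSpace E]

theorem HasResolventBound.differentiableOn_mlKernel {a : E} (hβ : 0 ≤ β)
    (h : HasResolventBound α β C a) : DifferentiableOn ℂ (mlKernel α a) {z | β < z.re} := by
  intro μ hμ
  have hre : 0 < μ.re := hβ.trans_lt hμ
  have h0 : μ ≠ 0 := by rintro rfl; simp at hre
  have hp : DifferentiableAt ℂ (fun z : ℂ => z ^ (α : ℂ)) μ :=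
    differentiableAt_id.cpow (differentiableAt_const _) (Or.inl hre)
  have hr : DifferentiableAt ℂ (fun z : ℂ => resolvent a (z ^ (α : ℂ))) μ :=
    (spectrum.hasDerivAt_resolvent_const_left (h μ hμ).1).differentiableAt.comp
      (f := fun z : ℂ => z ^ (α : ℂ)) μ hp
  have hW : DifferentiableAt ℂ (scaledResolvent α a) μ := hp.smul hr
  have hi : DifferentiableAt ℂ (fun z : ℂ => (z ^ 2)⁻¹) μ :=
    (differentiableAt_pow 2).inv (pow_ne_zero 2 h0)
  exact (hi.smul ((hW.const_smul (1 - α : ℂ)).add ((hW.pow 2).const_smul (α : ℂ)))).differentiableWithinAt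

theorem differentiable_cexp_mul_const (t : ℝ) : Differentiable ℂ fun z : ℂ => Complex.exp (z * t) :=
  (differentiable_id.mul_const _).cexp

-- On a line far enough to the right the kernel is a power series in a, which is inverted term by
-- term.
open MeasureTheory in
theorem smul_mlFamily_eq_integral_of_norm_lt (hα : 0 < α) (a : E) {c t : ℝ} (hc : 0 < c)
    (hac : ‖a‖ < c ^ α) (ht : 0 < t) :
    ∫ y : ℝ, Complex.exp ((c + y * Complex.I) * t) • mlKernel α a (c + y * Complex.I)
      = ((2 * Real.pi * t : ℝ) : ℂ) • mlFamily ℂ α a t := by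
  set F : ℕ → ℝ → E := fun k y => (Complex.exp ((c + y * Complex.I) * t) *
    (c + y * Complex.I : ℂ) ^ (-((α * k + 2 : ℝ) : ℂ))) • (((α * k + 1 : ℝ) : ℂ) • a ^ k) with hF
  have hk : ∀ k : ℕ, 0 ≤ α * k := fun k => by positivity
  have hbd : ∀ (k : ℕ) (y : ℝ), ‖Complex.exp ((c + y * Complex.I) * t) *
      (c + y * Complex.I : ℂ) ^ (-((α * k + 2 : ℝ) : ℂ))‖
      ≤ Real.exp (c * t) * c ^ (-(α * k)) * (‖(c + y * Complex.I : ℂ)‖ ^ 2)⁻¹ := by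
    intro k y
    rw [norm_mul, norm_cexp_line, mul_assoc]
    gcongr
    have := norm_line_cpow_neg_le hc (r := α * k + 2) (by linarith [hk k]) y
    rwa [add_sub_cancel_right] at this
  have hcont : ∀ k : ℕ, Continuous fun y : ℝ => Complex.exp ((c + y * Complex.I) * t) *
      (c + y * Complex.I : ℂ) ^ (-((α * k + 2 : ℝ) : ℂ)) := fun k =>
    Continuous.mul (by fun_prop) (continuous_line_cpow hc _)
  have hint : ∀ k : ℕ, Integrable fun y : ℝ => Complex.exp ((c + y * Complex.I) * t) *
      (c + y * Complex.I : ℂ) ^ (-((α * k + 2 : ℝ) : ℂ)) := fun k =>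
    integrable_line_of_norm_le hc (hcont k) (hbd k)
  have hFint : ∀ k : ℕ, Integrable (F k) := fun k => (hint k).smul_const _
  have hnormF : ∀ k : ℕ, ∫ y : ℝ, ‖F k y‖ ≤ (Real.exp (c * t) * (Real.pi / c) * (1 + ‖(1 : E)‖)) *
      ((α * k + 1) * (‖a‖ / c ^ α) ^ k) := by
    intro k
    have h1 : ‖((α * k + 1 : ℝ) : ℂ) • a ^ k‖ ≤ (α * k + 1) * ((1 + ‖(1 : E)‖) * ‖a‖ ^ k) := by
      rw [norm_smul, Complex.norm_real, Real.norm_of_nonneg (by linarith [hk k])]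
      exact mul_le_mul_of_nonneg_left (norm_pow_le_one_add_mul a k) (by linarith [hk k])
    have h2 : c ^ (-(α * k)) = ((c ^ α) ^ k)⁻¹ := by
      rw [Real.rpow_neg hc.le, Real.rpow_mul hc.le, Real.rpow_natCast]
    calc ∫ y : ℝ, ‖F k y‖
        ≤ ∫ y : ℝ, Real.exp (c * t) * c ^ (-(α * k)) * ((α * k + 1) * ((1 + ‖(1 : E)‖) * ‖a‖ ^ k)) *
          (‖(c + y * Complex.I : ℂ)‖ ^ 2)⁻¹ := by
          refine integral_mono (hFint k).norm
            ((integrable_norm_add_mul_I_inv_sq hc).const_mul _) fun y => ?_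
          simp only [hF]
          rw [norm_smul, mul_right_comm]
          exact mul_le_mul (hbd k y) h1 (norm_nonneg _) (by positivity)
      _ = _ := by
          rw [integral_const_mul, integral_norm_add_mul_I_inv_sq hc, h2, div_pow]
          ring
  have hx0 : 0 ≤ ‖a‖ / c ^ α := by positivity
  have hx1 : ‖a‖ / c ^ α < 1 := (div_lt_one (by positivity)).2 hac
  have hsumm : Summable fun k : ℕ => (α * k + 1) * (‖a‖ / c ^ α) ^ k := by
    have h1 := (summable_pow_mul_geometric_of_norm_lt_one 1
      (r := ‖a‖ / c ^ α) (by rwa [Real.norm_of_nonneg hx0])).mul_left α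
    refine (h1.add (summable_geometric_of_lt_one hx0 hx1)).congr fun k => ?_
    simp only [pow_one]
    ring
  have hFsum : Summable fun k : ℕ => ∫ y : ℝ, ‖F k y‖ :=
    Summable.of_nonneg_of_le (fun k => integral_nonneg fun y => norm_nonneg _) hnormF
      (hsumm.mul_left _)
  have hmain := hasSum_integral_of_summable_integral_norm hFint hFsum
  have hterm : ∀ k : ℕ, ∫ y : ℝ, F k y
      = ((2 * Real.pi * t : ℝ) : ℂ) • (((mlCoeff α k t : ℝ) : ℂ) • a ^ k) := by
    intro k
    simp only [hF]
    rw [integral_smul_const, integral_line_cexp_mul_cpow (by linarith [hk k]) hc ht, smul_smul,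
      smul_smul, ← Complex.ofReal_mul, ← Complex.ofReal_mul]
    congr 2
    have hG : Real.Gamma (α * k + 2) = (α * k + 1) * Real.Gamma (α * k + 1) := by
      rw [← Real.Gamma_add_one (by linarith [hk k])]
      ring_nf
    have hG0 := (Gamma_mul_add_one_pos hα k).ne'
    have h1 : α * k + 1 ≠ 0 := by linarith [hk k]
    rw [mlCoeff, hG, show α * k + 2 - 1 = α * k + 1 by ring, Real.rpow_add_one ht.ne']
    field_simp
  have hlhs : ∀ y : ℝ, ∑' k, F k y
      = Complex.exp ((c + y * Complex.I) * t) • mlKernel α a (c + y * Complex.I) := by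
    intro y
    have h0 : (c + y * Complex.I : ℂ) ≠ 0 := Complex.slitPlane_ne_zero (add_mul_I_mem_slitPlane hc y)
    have h1 := hasSum_mlKernel (α := α) a h0
      (hac.trans_le (Real.rpow_le_rpow hc.le (le_norm_add_mul_I c y) hα.le))
    refine (HasSum.congr_fun (h1.const_smul (Complex.exp ((c + y * Complex.I) * t))) fun k => ?_).tsum_eq
    simp only [hF, smul_smul]
    congr 1
    ring
  simp_rw [hterm, hlhs] at hmain
  exact hmain.unique ((hasSum_mlFamily (𝕜 := ℂ) hα a ht.le).const_smul _)

/-- The line is moved right until the series converges; the resolvent bound makes the integrand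
holomorphic and O(|μ|⁻²) in between. -/
theorem HasResolventBound.integral_eq_smul_mlFamily (hα : 0 < α) (hβ : 0 ≤ β) {a : E}
    (h : HasResolventBound α β C a) {c t : ℝ} (hc : β < c) (ht : 0 < t) :
    ∫ y : ℝ, Complex.exp ((c + y * Complex.I) * t) • mlKernel α a (c + y * Complex.I)
      = ((2 * Real.pi * t : ℝ) : ℂ) • mlFamily ℂ α a t := by
  obtain ⟨c₂, hc₂, hac⟩ : ∃ c₂ : ℝ, c ≤ c₂ ∧ ‖a‖ < c₂ ^ α :=
    ((eventually_ge_atTop c).and ((tendsto_rpow_atTop hα).eventually_gt_atTop ‖a‖)).exists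
  rw [← smul_mlFamily_eq_integral_of_norm_lt hα a (by linarith) hac ht]
  exact integral_line_eq_of_norm_le (F := fun z => Complex.exp (z * t) • mlKernel α a z) hβ hc hc₂
    ((differentiable_cexp_mul_const t).differentiableOn.smul (h.differentiableOn_mlKernel hβ))
    fun z hz hz' => h.norm_integrand_le (hc.trans_le hz) ht.le hz'

theorem HasResolventBound.norm_mlFamily_le (hα : 0 < α) (hβ : 0 ≤ β) {a : E}
    (h : HasResolventBound α β C a) {t : ℝ} (ht : 0 < t) :
    ‖mlFamily ℂ α a t‖ ≤ Real.exp 1 * (|1 - α| * C + |α| * C ^ 2) * Real.exp (β * t) := by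
  have hC := h.nonneg
  -- On the line c = β + 1/t the exponential has modulus e^{ct} = e · e^{βt}, and ct ≥ 1.
  have hc : β < β + 1 / t := by
    have : 0 < 1 / t := by positivity
    linarith
  have hct : (β + 1 / t) * t = β * t + 1 := by field_simp
  have h1 := norm_le_of_norm_integral_line_le (hβ.trans_lt hc) ht
    (by rw [hct]; nlinarith [mul_nonneg hβ ht.le])
    (by positivity : 0 ≤ Real.exp ((β + 1 / t) * t) * (|1 - α| * C + |α| * C ^ 2))
    (h.integral_eq_smul_mlFamily hα hβ hc ht)
    (fun y => h.norm_integrand_le (by simpa using hc) ht.le (by simp))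
  rw [hct, Real.exp_add] at h1
  linarith

/-- The inversion integrals of a and b are subtracted under the integral sign. On the line c = β +
1/t one has |μ| ≥ 1/t, so the extra μ^(-α) costs t^α. -/
theorem exists_mlFamily_sub_eq_mul (hα : 0 < α) (hβ : 0 ≤ β) {a b : E} (hab : Commute a b)
    (ha : HasResolventBound α β C a) (hb : HasResolventBound α β C b) {t : ℝ} (ht : 0 < t) :
    ∃ L : E, mlFamily ℂ α a t - mlFamily ℂ α b t = (a - b) * L ∧
      ‖L‖ ≤ Real.exp 1 * (|1 - α| * C ^ 2 + |α| * (2 * C ^ 3)) * (t ^ α * Real.exp (β * t)) := by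
  have hC := ha.nonneg
  have hc : β < β + 1 / t := by
    have : 0 < 1 / t := by positivity
    linarith
  have hct : (β + 1 / t) * t = β * t + 1 := by field_simp
  set c : ℝ := β + 1 / t with hcdef
  have hc0 : 0 < c := hβ.trans_lt hc
  set Q : ℝ → E := fun y => Complex.exp ((c + y * Complex.I) * t) •
    (((c + y * Complex.I : ℂ) ^ 2)⁻¹ • ((c + y * Complex.I : ℂ) ^ (α : ℂ))⁻¹ •
      ((1 - α : ℂ) • (scaledResolvent α a (c + y * Complex.I) *
          scaledResolvent α b (c + y * Complex.I)) +
        (α : ℂ) • ((scaledResolvent α a (c + y * Complex.I) *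
            scaledResolvent α b (c + y * Complex.I)) *
          (scaledResolvent α a (c + y * Complex.I) +
            scaledResolvent α b (c + y * Complex.I))))) with hQ
  have hre : ∀ y : ℝ, β < (c + y * Complex.I : ℂ).re := fun y => by simpa using hc
  have hne : ∀ y : ℝ, (c + y * Complex.I : ℂ) ≠ 0 := fun y =>
    Complex.slitPlane_ne_zero (add_mul_I_mem_slitPlane hc0 y)
  have hcontW : ∀ {a : E}, HasResolventBound α β C a →
      Continuous fun y : ℝ => scaledResolvent α a (c + y * Complex.I) := by
    intro a ha
    have hp := continuous_line_cpow hc0 (α : ℂ)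
    refine hp.smul (continuous_iff_continuousAt.2 fun y => ?_)
    exact ContinuousAt.comp (f := fun y : ℝ => (c + y * Complex.I : ℂ) ^ (α : ℂ))
      (spectrum.hasDerivAt_resolvent_const_left (ha _ (hre y)).1).continuousAt hp.continuousAt
  have hQc : Continuous Q := by
    have h1 := hcontW ha
    have h2 := hcontW hb
    have h3 : Continuous fun y : ℝ => ((c + y * Complex.I : ℂ) ^ 2)⁻¹ :=
      Continuous.inv₀ (by fun_prop) fun y => pow_ne_zero 2 (hne y)
    have h4 : Continuous fun y : ℝ => ((c + y * Complex.I : ℂ) ^ (α : ℂ))⁻¹ :=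
      (continuous_line_cpow hc0 (α : ℂ)).inv₀ fun y => by simp [Complex.cpow_eq_zero_iff, hne y]
    fun_prop
  have hQb : ∀ y : ℝ, ‖Q y‖ ≤ (Real.exp (c * t) *
      (t ^ α * (|1 - α| * C ^ 2 + |α| * (2 * C ^ 3)))) * (‖(c + y * Complex.I : ℂ)‖ ^ 2)⁻¹ := by
    intro y
    have h1 := (ha _ (hre y)).2
    have h2 := (hb _ (hre y)).2
    have h12 : ‖scaledResolvent α a (c + y * Complex.I) * scaledResolvent α b (c + y * Complex.I)‖
        ≤ C ^ 2 := (norm_mul_le _ _).trans (by rw [sq]; gcongr)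
    have hta : ‖((c + y * Complex.I : ℂ) ^ (α : ℂ))⁻¹‖ ≤ t ^ α := by
      rw [norm_inv, Complex.norm_cpow_real, ← Real.inv_rpow (norm_nonneg _)]
      refine Real.rpow_le_rpow (by positivity) ?_ hα.le
      rw [inv_le_comm₀ (norm_pos_iff.2 (hne y)) ht]
      refine le_trans ?_ (le_norm_add_mul_I c y)
      rw [hcdef, one_div]
      linarith
    simp only [hQ]
    rw [norm_smul, norm_smul, norm_smul, norm_cexp_line, norm_inv (_ ^ 2), norm_pow]
    have h3 : ‖(1 - α : ℂ) • (scaledResolvent α a (c + y * Complex.I) *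
          scaledResolvent α b (c + y * Complex.I)) +
        (α : ℂ) • ((scaledResolvent α a (c + y * Complex.I) *
            scaledResolvent α b (c + y * Complex.I)) *
          (scaledResolvent α a (c + y * Complex.I) +
            scaledResolvent α b (c + y * Complex.I)))‖ ≤ |1 - α| * C ^ 2 + |α| * (2 * C ^ 3) := by
      refine (norm_add_le _ _).trans ?_
      rw [norm_smul, norm_smul, ← Complex.ofReal_one, ← Complex.ofReal_sub, Complex.norm_real,
        Complex.norm_real, Real.norm_eq_abs, Real.norm_eq_abs]
      gcongr
      refine (norm_mul_le _ _).trans ?_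
      calc _ ≤ C ^ 2 * (C + C) := by
            gcongr
            exact (norm_add_le _ _).trans (add_le_add h1 h2)
        _ = 2 * C ^ 3 := by ring
    calc _ ≤ Real.exp (c * t) * ((‖(c + y * Complex.I : ℂ)‖ ^ 2)⁻¹ *
          (t ^ α * (|1 - α| * C ^ 2 + |α| * (2 * C ^ 3)))) := by gcongr
      _ = _ := by ring
  have hQint : MeasureTheory.Integrable Q := integrable_line_of_norm_le hc0 hQc hQb
  refine ⟨((2 * Real.pi * t : ℝ) : ℂ)⁻¹ • ∫ y : ℝ, Q y, ?_, ?_⟩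
  · have hpi := Real.pi_pos
    have h2 : ((2 * Real.pi * t : ℝ) : ℂ) ≠ 0 := by
      exact_mod_cast (by positivity : (2 * Real.pi * t : ℝ) ≠ 0)
    have hint : ∀ {a : E}, HasResolventBound α β C a → MeasureTheory.Integrable fun y : ℝ =>
        Complex.exp ((c + y * Complex.I) * t) • mlKernel α a (c + y * Complex.I) := by
      intro a ha
      refine integrable_line_of_norm_le hc0 ?_
        fun y => ha.norm_integrand_le (hre y) ht.le (c := c) (by simp)
      exact Continuous.smul (by fun_prop)
        ((ha.differentiableOn_mlKernel hβ).continuousOn.comp_continuous (by fun_prop) hre)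
    have h3 : ∫ y : ℝ, (a - b) * Q y
        = ((2 * Real.pi * t : ℝ) : ℂ) • (mlFamily ℂ α a t - mlFamily ℂ α b t) := by
      rw [smul_sub, ← ha.integral_eq_smul_mlFamily hα hβ hc ht,
        ← hb.integral_eq_smul_mlFamily hα hβ hc ht, ← MeasureTheory.integral_sub (hint ha) (hint hb)]
      refine MeasureTheory.integral_congr_ae (Eventually.of_forall fun y => ?_)
      simp only [hQ]
      rw [← smul_sub, mlKernel_sub hab (hne y) (ha _ (hre y)).1 (hb _ (hre y)).1, mul_smul_comm]
    have h4 : ∫ y : ℝ, (a - b) * Q y = (a - b) * (∫ y : ℝ, Q y) :=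
      (ContinuousLinearMap.mul ℂ E (a - b)).integral_comp_comm hQint
    rw [mul_smul_comm, ← h4, h3, smul_smul, inv_mul_cancel₀ h2, one_smul]
  · have hpi := Real.pi_pos
    have h2 : ((2 * Real.pi * t : ℝ) : ℂ) ≠ 0 := by
      exact_mod_cast (by positivity : (2 * Real.pi * t : ℝ) ≠ 0)
    have h1 := norm_le_of_norm_integral_line_le hc0 ht
      (by rw [hct]; nlinarith [mul_nonneg hβ ht.le]) (by positivity)
      (S := ((2 * Real.pi * t : ℝ) : ℂ)⁻¹ • ∫ y : ℝ, Q y)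
      (by rw [smul_smul, mul_inv_cancel₀ h2, one_smul]) hQb
    rw [hct, Real.exp_add] at h1
    linarith

end bounds

/-! ### Scalar inequalities for the substitution (1 - q)² = 4qN. -/

section scalars

/-- Parametrization of the resolvent set of the second difference by the unit disc. -/
theorem exists_joukowsky {N : ℂ} (hN : 1 < ‖N‖ + ‖1 + N‖) :
    ∃ q : ℂ, q ≠ 0 ∧ ‖q‖ < 1 ∧ (1 - q) ^ 2 = 4 * q * N ∧ (1 + q) ^ 2 = 4 * q * (1 + N) ∧
      1 + ‖q‖ ^ 2 = 2 * ‖q‖ * (‖N‖ + ‖1 + N‖) := by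
  -- The candidates 1 + 2N ± s are the roots of q² - 2(1 + 2N)q + 1. Their product is 1, so one lies
  -- in the closed unit disc.
  obtain ⟨s, hs⟩ := IsAlgClosed.exists_pow_nat_eq ((1 + 2 * N) ^ 2 - 1) (n := 2) two_pos
  have hroot : ∀ q : ℂ, q ^ 2 = 2 * (1 + 2 * N) * q - 1 → ‖q‖ ≤ 1 →
      q ≠ 0 ∧ ‖q‖ < 1 ∧ (1 - q) ^ 2 = 4 * q * N ∧ (1 + q) ^ 2 = 4 * q * (1 + N) ∧
      1 + ‖q‖ ^ 2 = 2 * ‖q‖ * (‖N‖ + ‖1 + N‖) := by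
    intro q hq hq1
    have h1 : (1 - q) ^ 2 = 4 * q * N := by linear_combination hq
    have h2 : (1 + q) ^ 2 = 4 * q * (1 + N) := by linear_combination hq
    have h0 : q ≠ 0 := by rintro rfl; norm_num at hq
    -- Adding |1 - q|² and |1 + q|² yields the last identity; there |q| = 1 would force |N| + |1 +
    -- N| = 1.
    have hpar := parallelogram_law_with_norm ℝ (1 : ℂ) q
    have n1 : ‖1 - q‖ ^ 2 = 4 * ‖q‖ * ‖N‖ := by rw [← norm_pow, h1]; simp
    have n2 : ‖1 + q‖ ^ 2 = 4 * ‖q‖ * ‖1 + N‖ := by rw [← norm_pow, h2]; simp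
    have h3 : 1 + ‖q‖ ^ 2 = 2 * ‖q‖ * (‖N‖ + ‖1 + N‖) := by
      rw [norm_one] at hpar
      nlinarith
    refine ⟨h0, lt_of_le_of_ne hq1 fun h => ?_, h1, h2, h3⟩
    rw [h] at h3
    linarith
  by_cases h : ‖1 + 2 * N + s‖ ≤ 1
  · exact ⟨_, hroot _ (by linear_combination hs) h⟩
  · refine ⟨_, hroot (1 + 2 * N - s) (by linear_combination hs) ?_⟩
    have hp : ‖1 + 2 * N - s‖ * ‖1 + 2 * N + s‖ = 1 := by
      rw [← norm_mul, show (1 + 2 * N - s) * (1 + 2 * N + s) = 1 by linear_combination -hs, norm_one]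
    nlinarith [norm_nonneg (1 + 2 * N - s)]

/-- The sector condition keeps N away from -1: |1 + N|² ≥ (1 - κ)(1 - |N|)² + κ(1 + |N|²). -/
theorem norm_one_add_ge {κ : ℝ} (hκ : 0 < κ) (hκ1 : κ ≤ 1) {N : ℂ} (hN : κ * ‖N‖ ≤ ‖N‖ + N.re) :
    κ / 2 * (1 + ‖N‖) ≤ ‖1 + N‖ := by
  have hsq : ‖1 + N‖ ^ 2 = 1 + 2 * N.re + ‖N‖ ^ 2 := by
    rw [Complex.sq_norm, Complex.sq_norm, Complex.normSq_apply, Complex.normSq_apply]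
    simp
    ring
  refine abs_le_of_sq_le_sq' ?_ (norm_nonneg _) |>.2
  rw [hsq]
  nlinarith [sq_nonneg (1 - ‖N‖), norm_nonneg N, mul_nonneg (sub_nonneg.2 hκ1) (sq_nonneg (1 - ‖N‖)),
    mul_nonneg (mul_nonneg hκ.le (sub_nonneg.2 hκ1)) (sq_nonneg (1 + ‖N‖))]

/-- With b = |q|, n = |N|, m = |1 + N|, the squares of the three norms are 4bn, 4bm and 2b(n + m -
1). The claim reduces to κ²n ≤ 8bm(n + m - 1), the product of κ ≤ 8bm and κn ≤ n + m - 1. -/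
theorem norm_one_sub_le_of_joukowsky {κ : ℝ} (hκ : 0 < κ) (hκ1 : κ ≤ 1) {N q : ℂ}
    (hN : κ * ‖N‖ ≤ ‖N‖ + N.re) (hq1 : ‖q‖ < 1)
    (h1 : (1 - q) ^ 2 = 4 * q * N) (h2 : (1 + q) ^ 2 = 4 * q * (1 + N))
    (h3 : 1 + ‖q‖ ^ 2 = 2 * ‖q‖ * (‖N‖ + ‖1 + N‖)) :
    ‖1 - q‖ ≤ 2 / κ * (‖1 + q‖ * (1 - ‖q‖)) := by
  have n1 : ‖1 - q‖ ^ 2 = 4 * ‖q‖ * ‖N‖ := by rw [← norm_pow, h1]; simp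
  have n2 : ‖1 + q‖ ^ 2 = 4 * ‖q‖ * ‖1 + N‖ := by rw [← norm_pow, h2]; simp
  have hge := norm_one_add_ge hκ hκ1 hN
  have hX1 : ‖1 + N‖ ≤ 1 + ‖N‖ := (norm_add_le _ _).trans (by simp)
  have hX : κ * ‖N‖ + 1 ≤ ‖N‖ + ‖1 + N‖ := by
    have : 1 + N.re ≤ ‖1 + N‖ := by simpa using Complex.re_le_norm (1 + N)
    linarith
  have hb0 := norm_nonneg q
  have hn0 := norm_nonneg N
  set b := ‖q‖
  set n := ‖N‖
  set m := ‖1 + N‖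
  have hsq : (1 - b) ^ 2 = 2 * b * (n + m - 1) := by linear_combination h3
  have hsub : 0 ≤ 1 - b := by linarith
  refine abs_le_of_sq_le_sq' ?_ (by positivity) |>.2
  rw [mul_pow, mul_pow, n1, n2, hsq, div_pow, div_mul_eq_mul_div, le_div_iff₀ (by positivity)]
  have hbm : κ ≤ 8 * (b * m) := by
    have e1 : 1 ≤ 2 * b * (2 * (1 + n)) := by
      refine le_trans ?_ (mul_le_mul_of_nonneg_left (by linarith : n + m ≤ 2 * (1 + n)) (by positivity))
      rw [← h3]
      nlinarith
    have e2 : b * (κ / 2 * (1 + n)) ≤ b * m := mul_le_mul_of_nonneg_left hge hb0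
    nlinarith
  have e3 : κ * (κ * n) ≤ 8 * (b * m) * (n + m - 1) :=
    mul_le_mul hbm (by linarith) (by positivity) (by nlinarith)
  have := mul_le_mul_of_nonneg_left e3 (by positivity : 0 ≤ 4 * b)
  linarith

/-- Since (b + b⁻¹)/2 = cosh(log b), the hypothesis forces -log b ≥ 1.2 s. Hence b e^s ≤ b^{1/6},
and Bernoulli's inequality compares 1 - b with 1 - b^{1/6}. -/
theorem one_sub_mul_exp_ge {b s : ℝ} (hb : 0 < b) (hb1 : b < 1) (hs : 0 ≤ s) (hs1 : s ≤ 1 / 2)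
    (h : 1 + s ^ 2 ≤ (b + b⁻¹) / 2) : b * Real.exp s < 1 ∧ 1 - b ≤ 6 * (1 - b * Real.exp s) := by
  -- For s ≤ 1/2: cosh(1.2 s) ≤ exp(0.72 s²) ≤ 1/(1 - 0.72 s²) ≤ 1 + s².
  have h1 : Real.cosh (1.2 * s) ≤ Real.cosh (Real.log b) := by
    rw [Real.cosh_log hb]
    refine (Real.cosh_le_exp_half_sq _).trans (le_trans ?_ h)
    have h2 := Real.add_one_le_exp (-((1.2 * s) ^ 2 / 2))
    rw [Real.exp_neg] at h2
    have h3 : 0 < 1 - 0.72 * s ^ 2 := by nlinarith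
    have h4 : Real.exp ((1.2 * s) ^ 2 / 2) ≤ (1 - 0.72 * s ^ 2)⁻¹ := by
      rw [← inv_inv (Real.exp _)]
      refine inv_anti₀ h3 (le_trans (le_of_eq ?_) h2)
      ring
    refine h4.trans ?_
    rw [inv_le_iff_one_le_mul₀ h3]
    have : s ^ 2 ≤ 1 / 4 := by nlinarith
    nlinarith [mul_nonneg (sq_nonneg s) (sub_nonneg.2 this)]
  rw [Real.cosh_le_cosh, abs_of_nonneg (by positivity), abs_of_neg (Real.log_neg hb hb1)] at h1
  set z := Real.exp (Real.log b / 6) with hz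
  have hz0 : 0 < z := Real.exp_pos _
  have hz6 : z ^ 6 = b := by
    rw [hz, ← Real.exp_nat_mul]
    push_cast
    rw [mul_div_cancel₀ _ (by norm_num : (6 : ℝ) ≠ 0), Real.exp_log hb]
  have hr : b * Real.exp s ≤ z := by
    nth_rewrite 1 [← Real.exp_log hb]
    rw [← Real.exp_add]
    exact Real.exp_le_exp.2 (by linarith)
  have hz1 : z < 1 := Real.exp_lt_one_iff.2 (by linarith [Real.log_neg hb hb1])
  have hbern := one_add_mul_le_pow (a := z - 1) (by linarith) 6
  rw [add_sub_cancel, hz6] at hbern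
  push_cast at hbern
  exact ⟨hr.trans_lt hz1, by linarith⟩

end scalars

/-! ### The Chebyshev generating function and the resolvent of the second difference. -/

section chebyshev

variable {E : Type*} [NormedRing E] [NormedAlgebra ℂ E]

/-- The generating function of a sequence with the Chebyshev recursion. -/
theorem chebyshev_generating_mul {T : ℕ → E} (h0 : T 0 = 1)
    (hT : ∀ k, (2 : ℂ) • (T 1 * T (k + 1)) = T (k + 2) + T k) {q : ℂ}
    (hs : Summable fun k => q ^ k • T k) :
    (((1 + q ^ 2) : ℂ) • (1 : E) - (2 * q) • T 1) * ((2 : ℂ) • (∑' k, q ^ k • T k) - 1)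
      = (1 - q ^ 2 : ℂ) • 1 := by
  set P := ∑' k, q ^ k • T k with hP
  have e1 : P = 1 + ∑' k, q ^ (k + 1) • T (k + 1) := by
    rw [hP, hs.tsum_eq_zero_add, h0, pow_zero, one_smul]
  have hs1 : Summable fun k => q ^ (k + 1) • T (k + 1) := (summable_nat_add_iff 1).2 hs
  have e2 : ∑' k, q ^ (k + 1) • T (k + 1) = q • T 1 + ∑' k, q ^ (k + 2) • T (k + 2) := by
    rw [hs1.tsum_eq_zero_add]
    simp
  have hs2 : Summable fun k => q ^ (k + 2) • T (k + 2) := (summable_nat_add_iff 2).2 hs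
  have e3 : (2 * q) • (T 1 * ∑' k, q ^ (k + 1) • T (k + 1))
      = (∑' k, q ^ (k + 2) • T (k + 2)) + q ^ 2 • P := by
    rw [← hs1.tsum_mul_left, ← (hs1.mul_left (T 1)).tsum_const_smul, hP, ← hs.tsum_const_smul,
      ← hs2.tsum_add (hs.const_smul _)]
    refine tsum_congr fun k => ?_
    have := congrArg (fun e => q ^ (k + 2) • e) (hT k)
    simp only [smul_add, smul_smul] at this
    rw [mul_smul_comm, smul_smul, smul_smul, ← pow_add, add_comm 2 k, ← this]
    congr 1
    ring
  have e4 : (2 * q) • (T 1 * P) = (2 * q) • T 1 + (P - 1 - q • T 1 + q ^ 2 • P) := by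
    nth_rewrite 1 [e1]
    rw [mul_add, mul_one, smul_add, e3]
    congr 2
    rw [eq_sub_iff_add_eq, eq_sub_iff_add_eq]
    rw [e1, e2]
    abel
  rw [sub_mul, smul_mul_assoc, one_mul, smul_mul_assoc, mul_sub, mul_one, mul_smul_comm, smul_sub,
    smul_sub, smul_comm (2 * q) (2 : ℂ), e4]
  module

theorem mul_chebyshev_generating {T : ℕ → E} (h0 : T 0 = 1)
    (hT : ∀ k, (2 : ℂ) • (T 1 * T (k + 1)) = T (k + 2) + T k) (hc : ∀ k, Commute (T 1) (T k)) {q : ℂ}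
    (hs : Summable fun k => q ^ k • T k) :
    ((2 : ℂ) • (∑' k, q ^ k • T k) - 1) * (((1 + q ^ 2) : ℂ) • (1 : E) - (2 * q) • T 1)
      = (1 - q ^ 2 : ℂ) • 1 := by
  have hP : Commute (T 1) (∑' k, q ^ k • T k) := by
    rw [Commute, SemiconjBy, ← hs.tsum_mul_left, ← hs.tsum_mul_right]
    refine tsum_congr fun k => ?_
    rw [mul_smul_comm, smul_mul_assoc, (hc k).eq]
  rw [← chebyshev_generating_mul h0 hT hs]
  refine (Commute.sub_right ?_ ?_).eq
  · exact (Commute.one_right _).smul_right _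
  · exact ((hP.symm.smul_left _).sub_left (Commute.one_left _)).smul_right _

/-- A resolvent estimate for the second difference of a sequence with the Chebyshev recursion. -/
theorem norm_smul_resolvent_secondDifference_le [CompleteSpace E] {T : ℕ → E} (h0 : T 0 = 1)
    (hT : ∀ k, (2 : ℂ) • (T 1 * T (k + 1)) = T (k + 2) + T k) (hc : ∀ k, Commute (T 1) (T k))
    {M w h κ : ℝ} (hM : 1 ≤ M) (hw : 0 ≤ w) (hh : 0 < h) (hwh : w * h ≤ 1 / 2)
    (hTn : ∀ k : ℕ, ‖T k‖ ≤ M * Real.exp (w * h) ^ k) (hκ : 0 < κ) (hκ1 : κ ≤ 1) {ν : ℂ}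
    (hν : ν ≠ 0) (hν1 : κ * ‖ν‖ ≤ ‖ν‖ + ν.re) (hν2 : 4 * w ^ 2 ≤ ‖ν‖ + ν.re) :
    ν ∈ resolventSet ℂ (((2 / h ^ 2 : ℝ) : ℂ) • (T 1 - 1)) ∧
      ‖ν • resolvent (((2 / h ^ 2 : ℝ) : ℂ) • (T 1 - 1)) ν‖ ≤ 36 * M / κ := by
  -- In this scaling ν ↦ N the condition |ν| + Re ν ≥ 4w² becomes |N| + Re N ≥ (wh)², which is what
  -- makes |q| e^{wh} < 1.
  set N : ℂ := ((h ^ 2 / 4 : ℝ) : ℂ) * ν with hN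
  have hh2 : 0 < h ^ 2 / 4 := by positivity
  have hNn : ‖N‖ = h ^ 2 / 4 * ‖ν‖ := by
    rw [hN, norm_mul, Complex.norm_real, Real.norm_of_nonneg hh2.le]
  have hNre : N.re = h ^ 2 / 4 * ν.re := by rw [hN, Complex.re_ofReal_mul]
  have hN1 : κ * ‖N‖ ≤ ‖N‖ + N.re := by
    rw [hNn, hNre]; nlinarith
  have hre : 1 + N.re ≤ ‖1 + N‖ := by simpa using Complex.re_le_norm (1 + N)
  have hN0 : 0 < ‖N‖ := by
    rw [hNn]; have := norm_pos_iff.2 hν; positivity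
  have hX : 1 < ‖N‖ + ‖1 + N‖ := by nlinarith [mul_pos hκ hN0]
  obtain ⟨q, hq0, hq1, h1, h2, h3⟩ := exists_joukowsky hX
  have hqpos : 0 < ‖q‖ := norm_pos_iff.2 hq0
  have hX2 : 1 + (w * h) ^ 2 ≤ (‖q‖ + ‖q‖⁻¹) / 2 := by
    have e1 : (‖q‖ + ‖q‖⁻¹) / 2 = ‖N‖ + ‖1 + N‖ := by
      field_simp
      linarith
    rw [e1]
    have e2 : (w * h) ^ 2 ≤ ‖N‖ + N.re := by
      rw [hNn, hNre]; nlinarith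
    linarith
  obtain ⟨hr1, hr6⟩ := one_sub_mul_exp_ge hqpos hq1 (by positivity) hwh hX2
  set r := ‖q‖ * Real.exp (w * h) with hr
  have hr0 : 0 ≤ r := by positivity
  have hterm : ∀ k : ℕ, ‖q ^ k • T k‖ ≤ M * r ^ k := by
    intro k
    rw [norm_smul, norm_pow, hr, mul_pow, mul_left_comm]
    exact mul_le_mul_of_nonneg_left (hTn k) (by positivity)
  have hgeo := (hasSum_geometric_of_lt_one hr0 hr1).mul_left M
  have hs : Summable fun k => q ^ k • T k := Summable.of_norm_bounded hgeo.summable hterm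
  have hPn : ‖∑' k, q ^ k • T k‖ ≤ M * (1 - r)⁻¹ := tsum_of_norm_bounded hgeo hterm
  set P := ∑' k, q ^ k • T k with hP
  have hr1' : 0 < 1 - r := by linarith
  have hQn : ‖(2 : ℂ) • P - 1‖ ≤ 3 * M / (1 - r) := by
    have e1 : ‖(1 : E)‖ ≤ M * (1 - r)⁻¹ := by
      have e2 := hTn 0
      rw [h0, pow_zero, mul_one] at e2
      exact e2.trans (le_mul_of_one_le_right (by linarith) ((one_le_inv₀ hr1').2 (by linarith)))
    calc ‖(2 : ℂ) • P - 1‖ ≤ ‖(2 : ℂ) • P‖ + ‖(1 : E)‖ := norm_sub_le _ _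
      _ ≤ 2 * (M * (1 - r)⁻¹) + M * (1 - r)⁻¹ := by
          rw [norm_smul]
          simp only [Complex.norm_ofNat]
          gcongr
      _ = _ := by ring
  have hqm : 1 - q ≠ 0 := fun e => by
    rw [sub_eq_zero] at e; rw [← e] at hq1; simp at hq1
  have hqp : 1 + q ≠ 0 := fun e => by
    rw [add_eq_zero_iff_neg_eq] at e; rw [← e] at hq1; simp at hq1
  have hq2 : (1 - q ^ 2 : ℂ) ≠ 0 := by
    rw [show (1 - q ^ 2 : ℂ) = (1 - q) * (1 + q) by ring]
    exact mul_ne_zero hqm hqp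
  have hhC : (h : ℂ) ≠ 0 := by exact_mod_cast hh.ne'
  have hνq : (h : ℂ) ^ 2 * ν * q = (1 - q) ^ 2 := by
    rw [h1, hN]; push_cast; ring
  set a : E := ((2 / h ^ 2 : ℝ) : ℂ) • (T 1 - 1) with ha
  have hop : algebraMap ℂ E ν - a
      = ((h : ℂ) ^ 2 * q)⁻¹ • (((1 + q ^ 2) : ℂ) • (1 : E) - (2 * q) • T 1) := by
    have e1 : (1 + q ^ 2 : ℂ) = (h : ℂ) ^ 2 * ν * q + 2 * q := by rw [hνq]; ring
    rw [e1, Algebra.algebraMap_eq_smul_one, ha, smul_sub, smul_sub, smul_smul, smul_smul]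
    have e2 : ((h : ℂ) ^ 2 * q)⁻¹ * ((h : ℂ) ^ 2 * ν * q + 2 * q) = ν + ((2 / h ^ 2 : ℝ) : ℂ) := by
      push_cast; field_simp
    have e3 : ((h : ℂ) ^ 2 * q)⁻¹ * (2 * q) = ((2 / h ^ 2 : ℝ) : ℂ) := by
      push_cast; field_simp
    rw [e2, e3, add_smul]
    abel
  set R : E := ((h : ℂ) ^ 2 * q * (1 - q ^ 2)⁻¹) • ((2 : ℂ) • P - 1) with hR
  have hRl : (algebraMap ℂ E ν - a) * R = 1 := by
    rw [hop, hR, smul_mul_smul_comm, chebyshev_generating_mul h0 hT hs, smul_smul]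
    rw [show ((h : ℂ) ^ 2 * q)⁻¹ * ((h : ℂ) ^ 2 * q * (1 - q ^ 2)⁻¹) * (1 - q ^ 2) = 1 by
      field_simp, one_smul]
  have hRr : R * (algebraMap ℂ E ν - a) = 1 := by
    rw [hop, hR, smul_mul_smul_comm, mul_chebyshev_generating h0 hT hc hs, smul_smul]
    rw [show (h : ℂ) ^ 2 * q * (1 - q ^ 2)⁻¹ * ((h : ℂ) ^ 2 * q)⁻¹ * (1 - q ^ 2) = 1 by
      field_simp, one_smul]
  have hres : resolvent a ν = R :=
    Ring.inverse_unit (⟨algebraMap ℂ E ν - a, R, hRl, hRr⟩ : Eˣ)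
  refine ⟨spectrum.mem_resolventSet_of_left_right_inverse hRl hRr, ?_⟩
  have hcoef : ν * ((h : ℂ) ^ 2 * q * (1 - q ^ 2)⁻¹) = (1 - q) / (1 + q) := by
    rw [show ν * ((h : ℂ) ^ 2 * q * (1 - q ^ 2)⁻¹) = (h : ℂ) ^ 2 * ν * q * (1 - q ^ 2)⁻¹ by ring,
      hνq, show (1 - q ^ 2 : ℂ) = (1 - q) * (1 + q) by ring]
    field_simp
  have hK := norm_one_sub_le_of_joukowsky hκ hκ1 hN1 hq1 h1 h2 h3
  have hqp' : 0 < ‖1 + q‖ := norm_pos_iff.2 hqp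
  rw [hres, hR, smul_smul, hcoef, norm_smul, norm_div]
  have hK' : ‖1 - q‖ / ‖1 + q‖ ≤ 2 / κ * (6 * (1 - r)) := by
    rw [div_le_iff₀ hqp']
    refine hK.trans ?_
    rw [mul_assoc, mul_comm ‖1 + q‖]
    gcongr
  -- The constant is 36 = 2 · 6 · 3: from the bound on |1 - q|, from replacing 1 - |q| by 1 - r, and
  -- from ‖2P - 1‖.
  calc ‖1 - q‖ / ‖1 + q‖ * ‖(2 : ℂ) • P - 1‖
      ≤ 2 / κ * (6 * (1 - r)) * (3 * M / (1 - r)) := by gcongr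
    _ = 36 * M / κ := by field_simp; ring

end chebyshev

/-! ### The map μ ↦ μ^α on the right half-plane. -/

section sector

/-- Bernoulli bounds (cos φ)^γ by γ cos φ + (1 - γ) cos 0, and concavity of the cosine finishes. -/
theorem cos_rpow_le_cos_mul {γ φ : ℝ} (hγ : 0 ≤ γ) (hγ1 : γ ≤ 1) (hφ : |φ| ≤ Real.pi / 2) :
    Real.cos φ ^ γ ≤ Real.cos (γ * φ) := by
  have hφ' := abs_le.1 hφ
  have hc : 0 ≤ Real.cos φ := Real.cos_nonneg_of_neg_pi_div_two_le_of_le hφ'.1 hφ'.2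
  have h1 := rpow_one_add_le_one_add_mul_self (s := Real.cos φ - 1) (by linarith) hγ hγ1
  have h2 := strictConcaveOn_cos_Icc.concaveOn.2 (x := φ) (y := 0) ⟨hφ'.1, hφ'.2⟩
    ⟨by linarith [Real.pi_pos], by linarith [Real.pi_pos]⟩ hγ (sub_nonneg.2 hγ1) (by ring)
  simp only [smul_eq_mul, Real.cos_zero, mul_zero, add_zero, mul_one] at h2
  rw [add_sub_cancel] at h1
  linarith

theorem norm_add_re_cpow (μ : ℂ) (α : ℝ) :
    ‖μ ^ (α : ℂ)‖ + (μ ^ (α : ℂ)).re = ‖μ‖ ^ α * (1 + Real.cos (α * μ.arg)) := by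
  rw [Complex.norm_cpow_real, Complex.cpow_ofReal_re, mul_comm μ.arg]
  ring

/-- Here |α arg μ| < πα/2 < π, so μ^α avoids a sector around the negative axis. Halving the constant
keeps it at most 1, as κ must be. -/
theorem norm_add_re_cpow_ge {α : ℝ} (hα : 0 < α) (hα2 : α < 2) {μ : ℂ} (hμ : 0 < μ.re) :
    (1 + Real.cos (Real.pi * α / 2)) / 2 * ‖μ ^ (α : ℂ)‖ ≤ ‖μ ^ (α : ℂ)‖ + (μ ^ (α : ℂ)).re := by
  have harg : |μ.arg| < Real.pi / 2 := Complex.abs_arg_lt_pi_div_two_iff.2 (Or.inl hμ)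
  have hpi := Real.pi_pos
  have hcos : Real.cos (Real.pi * α / 2) ≤ Real.cos (α * μ.arg) := by
    rw [← Real.cos_abs (α * μ.arg), abs_mul, abs_of_pos hα]
    refine Real.cos_le_cos_of_nonneg_of_le_pi (by positivity) (by nlinarith) (by nlinarith)
  rw [norm_add_re_cpow μ α, Complex.norm_cpow_real, mul_comm]
  refine mul_le_mul_of_nonneg_left ?_ (by positivity)
  have := Real.neg_one_le_cos (Real.pi * α / 2)
  linarith

/-- With θ = arg μ, 1 + cos(αθ) = 2cos²(αθ/2) ≥ 2(cos θ)^α. -/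
theorem two_mul_re_rpow_le {α : ℝ} (hα : 0 < α) (hα2 : α < 2) {μ : ℂ} (hμ : 0 < μ.re) :
    2 * μ.re ^ α ≤ ‖μ ^ (α : ℂ)‖ + (μ ^ (α : ℂ)).re := by
  have harg : |μ.arg| < Real.pi / 2 := Complex.abs_arg_lt_pi_div_two_iff.2 (Or.inl hμ)
  have hc : 0 < Real.cos μ.arg := Real.cos_pos_of_mem_Ioo (abs_lt.1 harg)
  have h1 := cos_rpow_le_cos_mul (γ := α / 2) (by positivity) (by linarith) harg.le
  have h2 : μ.re ^ α = ‖μ‖ ^ α * (Real.cos μ.arg ^ (α / 2)) ^ 2 := by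
    rw [← Real.rpow_natCast, ← Real.rpow_mul hc.le, ← Complex.norm_mul_cos_arg μ,
      Real.mul_rpow (norm_nonneg _) hc.le]
    congr 2
    push_cast
    ring
  have h3 : 1 + Real.cos (α * μ.arg) = 2 * Real.cos (α / 2 * μ.arg) ^ 2 := by
    rw [Real.cos_sq]
    ring_nf
  rw [norm_add_re_cpow μ α, h2, h3, mul_left_comm]
  gcongr

end sector

section secondDifference

variable {E : Type*} [NormedRing E] [NormedAlgebra ℂ E] [CompleteSpace E]

/-- The abscissa is chosen so that (Re μ)^α > 2w², whence |μ^α| + Re μ^α ≥ 4w². -/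
theorem hasResolventBound_secondDifference {T : ℕ → E} (h0 : T 0 = 1)
    (hT : ∀ k, (2 : ℂ) • (T 1 * T (k + 1)) = T (k + 2) + T k) (hc : ∀ k, Commute (T 1) (T k))
    {M w h α : ℝ} (hM : 1 ≤ M) (hw : 0 ≤ w) (hh : 0 < h) (hwh : w * h ≤ 1 / 2)
    (hTn : ∀ k : ℕ, ‖T k‖ ≤ M * Real.exp (w * h) ^ k) (hα : 0 < α) (hα2 : α < 2) :
    HasResolventBound α ((2 * w ^ 2) ^ (1 / α))
      (36 * M / ((1 + Real.cos (Real.pi * α / 2)) / 2)) (((2 / h ^ 2 : ℝ) : ℂ) • (T 1 - 1)) := by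
  intro μ hμ
  have hb : 0 ≤ (2 * w ^ 2) ^ (1 / α) := by positivity
  have hre : 0 < μ.re := hb.trans_lt hμ
  have hμ0 : μ ≠ 0 := by rintro rfl; simp at hre
  have hpi := Real.pi_pos
  have hcos : -1 < Real.cos (Real.pi * α / 2) := by
    rw [← Real.cos_pi]
    exact Real.cos_lt_cos_of_nonneg_of_le_pi (by positivity) le_rfl (by nlinarith)
  refine norm_smul_resolvent_secondDifference_le h0 hT hc hM hw hh hwh hTn (by linarith)
    (by linarith [Real.cos_le_one (Real.pi * α / 2)]) (by simp [Complex.cpow_eq_zero_iff, hμ0])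
    (norm_add_re_cpow_ge hα hα2 hre) (le_trans ?_ (two_mul_re_rpow_le hα hα2 hre))
  have h1 : ((2 * w ^ 2) ^ (1 / α)) ^ α ≤ μ.re ^ α := Real.rpow_le_rpow hb hμ.le hα.le
  rw [← Real.rpow_mul (by positivity), one_div_mul_cancel hα.ne', Real.rpow_one] at h1
  linarith

end secondDifference

/-! ### Transfer of the estimates to real or complex Banach spaces by duality. -/

section duality

variable {𝕜 : Type*} [RCLike 𝕜] {B : Type*} [NormedAddCommGroup B] [NormedSpace 𝕜 B]
  [NormedSpace ℝ B] [IsScalarTower ℝ 𝕜 B]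

/-- The action of an operator on the complex-valued real-linear functionals. -/
noncomputable def complexDual : (B →L[𝕜] B) →+ ((B →L[ℝ] ℂ) →L[ℂ] (B →L[ℝ] ℂ)) where
  toFun P := LinearMap.mkContinuous
    { toFun := fun φ => φ.comp (P.restrictScalars ℝ)
      map_add' := fun φ ψ => ContinuousLinearMap.add_comp φ ψ _
      map_smul' := fun c φ => ContinuousLinearMap.smul_comp c φ _ } ‖P‖ (fun φ => by
        refine ContinuousLinearMap.opNorm_le_bound _ (by positivity) fun x => ?_
        calc ‖φ (P x)‖ ≤ ‖φ‖ * (‖P‖ * ‖x‖) :=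
              φ.le_of_opNorm_le_of_le le_rfl (P.le_opNorm x)
          _ = ‖P‖ * ‖φ‖ * ‖x‖ := by ring)
  map_zero' := by
    ext φ x
    simp
  map_add' P Q := by
    ext φ x
    simp

@[simp] theorem complexDual_apply (P : B →L[𝕜] B) (φ : B →L[ℝ] ℂ) (x : B) :
    complexDual P φ x = φ (P x) := rfl

theorem norm_complexDual_le (P : B →L[𝕜] B) : ‖complexDual P‖ ≤ ‖P‖ :=
  ContinuousLinearMap.opNorm_le_bound _ (norm_nonneg P) fun φ =>
    ContinuousLinearMap.opNorm_le_bound _ (by positivity) fun x =>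
      (φ.le_of_opNorm_le_of_le le_rfl (P.le_opNorm x)).trans_eq (by ring)

theorem complexDual_one : complexDual (1 : B →L[𝕜] B) = 1 := rfl

theorem complexDual_mul (P Q : B →L[𝕜] B) :
    complexDual (P * Q) = complexDual Q * complexDual P := rfl

theorem complexDual_sub (P Q : B →L[𝕜] B) :
    complexDual (P - Q) = complexDual P - complexDual Q :=
  ContinuousLinearMap.ext fun φ => ContinuousLinearMap.ext fun x => map_sub φ (P x) (Q x)

theorem complexDual_pow (P : B →L[𝕜] B) (k : ℕ) : complexDual (P ^ k) = complexDual P ^ k := by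
  induction k with
  | zero => rfl
  | succ k ih => rw [pow_succ, complexDual_mul, ih, pow_succ']

theorem complexDual_smul (r : ℝ) (P : B →L[𝕜] B) :
    complexDual ((r : 𝕜) • P) = (r : ℂ) • complexDual P := by
  ext φ x
  change φ ((r : 𝕜) • P x) = (r : ℂ) • φ (P x)
  rw [← RCLike.real_smul_eq_coe_smul (K := 𝕜), φ.map_smul, Complex.coe_smul]

theorem Commute.complexDual {P Q : B →L[𝕜] B} (h : Commute P Q) :
    Commute (_root_.complexDual P) (_root_.complexDual Q) := by
  rw [Commute, SemiconjBy, ← complexDual_mul, ← complexDual_mul, h.eq]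

/-- A real norming functional from Hahn–Banach, viewed as complex-valued, suffices. -/
theorem norm_le_of_forall_complexDual {y : B} {K : ℝ}
    (h : ∀ φ : B →L[ℝ] ℂ, ‖φ‖ ≤ 1 → ‖φ y‖ ≤ K) : ‖y‖ ≤ K := by
  obtain ⟨g, hg, hgy⟩ := exists_dual_vector'' ℝ y
  have h1 := h (Complex.ofRealCLM.comp g) ?_
  · simpa [hgy] using h1
  · refine (ContinuousLinearMap.opNorm_comp_le _ _).trans ?_
    simpa using hg

variable [CompleteSpace B] {α β C : ℝ}

theorem complexDual_mlFamily (hα : 0 < α) (P : B →L[𝕜] B) {t : ℝ} (ht : 0 ≤ t) :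
    complexDual (mlFamily 𝕜 α P t) = mlFamily ℂ α (complexDual P) t := by
  have hc : Continuous (complexDual : (B →L[𝕜] B) →+ ((B →L[ℝ] ℂ) →L[ℂ] (B →L[ℝ] ℂ))) := by
    refine AddMonoidHomClass.continuous_of_bound (complexDual (𝕜 := 𝕜) (B := B)) 1 fun P => ?_
    rw [one_mul]
    exact norm_complexDual_le P
  have h := (hasSum_mlFamily (𝕜 := 𝕜) hα P ht).map complexDual hc
  refine h.unique ((hasSum_mlFamily (𝕜 := ℂ) hα (complexDual P) ht).congr_fun fun k => ?_)
  simp only [Function.comp_apply]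
  rw [complexDual_smul, complexDual_pow]
  rfl

/-- The extra summand 1 covers t = 0, where the line Re μ = β + 1/t is not available. -/
theorem norm_mlFamily_le_of_complexDual (hα : 0 < α) (hβ : 0 ≤ β) {P : B →L[𝕜] B}
    (h : HasResolventBound α β C (complexDual P)) {t : ℝ} (ht : 0 ≤ t) :
    ‖mlFamily 𝕜 α P t‖
      ≤ (1 + Real.exp 1 * (|1 - α| * C + |α| * C ^ 2)) * Real.exp (β * t) := by
  have hC := h.nonneg
  rcases ht.eq_or_lt with rfl | ht
  · rw [mlFamily_zero hα, mul_zero, Real.exp_zero, mul_one]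
    refine ContinuousLinearMap.norm_id_le.trans ?_
    have : 0 ≤ Real.exp 1 * (|1 - α| * C + |α| * C ^ 2) := by positivity
    linarith
  · refine ContinuousLinearMap.opNorm_le_bound _ (by positivity) fun x => ?_
    refine norm_le_of_forall_complexDual fun φ hφ => ?_
    have h1 := h.norm_mlFamily_le hα hβ ht
    rw [← complexDual_mlFamily hα P ht.le] at h1
    have h2 : ‖complexDual (mlFamily 𝕜 α P t) φ‖ ≤
        Real.exp 1 * (|1 - α| * C + |α| * C ^ 2) * Real.exp (β * t) * 1 :=
      ContinuousLinearMap.le_of_opNorm_le_of_le _ h1 hφ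
    have h3 := ContinuousLinearMap.le_of_opNorm_le _ h2 x
    rw [complexDual_apply] at h3
    refine h3.trans ?_
    rw [mul_one, add_mul, one_mul]
    gcongr
    linarith [Real.exp_pos (β * t)]

theorem norm_mlFamily_sub_apply_le (hα : 0 < α) (hβ : 0 ≤ β) {P Q : B →L[𝕜] B}
    (hPQ : Commute P Q) (hP : HasResolventBound α β C (complexDual P))
    (hQ : HasResolventBound α β C (complexDual Q)) {t : ℝ} (ht : 0 ≤ t) (x : B) :
    ‖mlFamily 𝕜 α P t x - mlFamily 𝕜 α Q t x‖
      ≤ Real.exp 1 * (|1 - α| * C ^ 2 + |α| * (2 * C ^ 3)) * (t ^ α * Real.exp (β * t)) *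
        ‖P x - Q x‖ := by
  have hC := hP.nonneg
  rcases ht.eq_or_lt with rfl | ht
  · rw [mlFamily_zero hα, mlFamily_zero hα, sub_self, norm_zero]
    positivity
  · obtain ⟨L, hL, hLn⟩ := exists_mlFamily_sub_eq_mul hα hβ hPQ.complexDual hP hQ ht
    refine norm_le_of_forall_complexDual fun φ hφ => ?_
    rw [← complexDual_mlFamily hα P ht.le, ← complexDual_mlFamily hα Q ht.le] at hL
    have h1 : φ (mlFamily 𝕜 α P t x - mlFamily 𝕜 α Q t x) = L φ (P x - Q x) := by
      -- `complexDual` reverses products, so the left factor of (a - b) * L acts first on x.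
      have h2 := congrArg (fun S => S φ x) hL
      change φ (mlFamily 𝕜 α P t x) - φ (mlFamily 𝕜 α Q t x) = L φ (P x) - L φ (Q x) at h2
      rw [map_sub, map_sub, h2]
    rw [h1]
    have h2 := ContinuousLinearMap.le_of_opNorm_le_of_le L hLn hφ
    rw [mul_one] at h2
    exact ContinuousLinearMap.le_of_opNorm_le _ h2 _

end duality

/-! ### Second antiderivatives. -/

section second_antiderivative

variable {B : Type*} [NormedAddCommGroup B] [NormedSpace ℝ B]

/-- The second antiderivative of `f` that vanishes at `0` together with its derivative. -/
noncomputable def secondAntideriv (f : ℝ → B) (t : ℝ) : B :=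
  ∫ s in (0 : ℝ)..t, (t - s) • f s

theorem intervalIntegrable_sub_smul {f : ℝ → B} (hf : Continuous f) (c a b : ℝ) :
    IntervalIntegrable (fun r => (c - r) • f r) MeasureTheory.volume a b :=
  ((continuous_const.sub continuous_id).smul hf).intervalIntegrable a b

theorem secondAntideriv_even {f : ℝ → B} (hf : ∀ s, f (-s) = f s) (t : ℝ) :
    secondAntideriv f (-t) = secondAntideriv f t := by
  have h := intervalIntegral.integral_comp_neg (a := 0) (b := t) (fun s => (-t - s) • f s)
  rw [neg_zero] at h
  rw [secondAntideriv, intervalIntegral.integral_symm, ← h, ← intervalIntegral.integral_neg,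
    secondAntideriv]
  refine intervalIntegral.integral_congr fun s _ => ?_
  simp only [hf]
  rw [← neg_smul]
  congr 1
  ring

theorem integral_sub_smul_comp_add {f : ℝ → B} (hf : Continuous f) (a t : ℝ) :
    ∫ s in (0 : ℝ)..t, (t - s) • f (a + s)
      = secondAntideriv f (a + t) - secondAntideriv f a - t • ∫ s in (0 : ℝ)..a, f s := by
  have h := intervalIntegral.integral_comp_add_left (a := 0) (b := t)
    (fun r => (a + t - r) • f r) a
  simp only [add_sub_add_left_eq_sub, add_zero] at h
  have hi := intervalIntegrable_sub_smul hf
  have hi' : IntervalIntegrable (fun r => t • f r) MeasureTheory.volume 0 a :=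
    (hf.const_smul t).intervalIntegrable _ _
  rw [h, ← intervalIntegral.integral_interval_sub_left (hi _ 0 _) (hi _ 0 _), secondAntideriv,
    secondAntideriv, sub_sub]
  congr 1
  rw [← intervalIntegral.integral_smul, ← intervalIntegral.integral_add (hi _ _ _) hi']
  refine intervalIntegral.integral_congr fun s _ => ?_
  rw [← add_smul]
  congr 1
  ring

/-- Use the one-sided formula at t and at -t: the terms t ∫₀ᵃ f cancel. -/
theorem integral_sub_smul_symm {f : ℝ → B} (hf : Continuous f) (a t : ℝ) :
    ∫ s in (0 : ℝ)..t, (t - s) • (f (a + s) + f (a - s))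
      = secondAntideriv f (a + t) + secondAntideriv f (a - t) - (2 : ℝ) • secondAntideriv f a := by
  have h1 := integral_sub_smul_comp_add hf a t
  have h2 := integral_sub_smul_comp_add hf a (-t)
  have h3 := intervalIntegral.integral_comp_neg (a := 0) (b := t) (fun s => (-t - s) • f (a + s))
  rw [neg_zero, intervalIntegral.integral_symm 0 (-t), h2] at h3
  have h4 : ∫ s in (0 : ℝ)..t, (t - s) • f (a - s) = -∫ s in (0 : ℝ)..t, (-t - -s) • f (a + -s) := by
    rw [← intervalIntegral.integral_neg]
    refine intervalIntegral.integral_congr fun s _ => ?_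
    rw [← neg_smul, ← sub_eq_add_neg]
    congr 1
    ring
  simp_rw [smul_add]
  rw [intervalIntegral.integral_add (Continuous.intervalIntegrable (by fun_prop) _ _)
    (Continuous.intervalIntegrable (by fun_prop) _ _), h1, h4, h3, ← sub_eq_add_neg]
  module

variable [CompleteSpace B]

theorem tendsto_two_div_sq_smul_secondAntideriv {f : ℝ → B} (hf : Continuous f) :
    Tendsto (fun t : ℝ => (2 / t ^ 2) • secondAntideriv f t) (𝓝[>] 0) (𝓝 (f 0)) := by
  rw [Metric.tendsto_nhdsWithin_nhds]
  intro ε hε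
  obtain ⟨δ, hδ, hfδ⟩ := Metric.continuous_iff.1 hf 0 (ε / 2) (by positivity)
  refine ⟨δ, hδ, fun t ht htδ => ?_⟩
  have ht0 : (0 : ℝ) < t := ht
  rw [Real.dist_eq, sub_zero, abs_of_pos ht0] at htδ
  have hconst : ∫ s in (0 : ℝ)..t, (t - s) = t ^ 2 / 2 := by
    rw [intervalIntegral.integral_sub (by simp) (by simp)]
    simp
    ring
  have h1 : secondAntideriv f t - (t ^ 2 / 2) • f 0
      = ∫ s in (0 : ℝ)..t, (t - s) • (f s - f 0) := by
    simp_rw [smul_sub]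
    rw [intervalIntegral.integral_sub (Continuous.intervalIntegrable (by fun_prop) _ _)
      (Continuous.intervalIntegrable (by fun_prop) _ _), intervalIntegral.integral_smul_const, hconst]
    rfl
  have h2 : ‖∫ s in (0 : ℝ)..t, (t - s) • (f s - f 0)‖ ≤ t ^ 2 / 2 * (ε / 2) := by
    rw [← hconst, ← intervalIntegral.integral_mul_const]
    refine intervalIntegral.norm_integral_le_of_norm_le ht0.le (Eventually.of_forall fun s hs => ?_)
      (Continuous.intervalIntegrable (by fun_prop) _ _)
    rw [norm_smul, Real.norm_of_nonneg (sub_nonneg.2 hs.2), ← dist_eq_norm]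
    refine mul_le_mul_of_nonneg_left (hfδ s ?_).le (sub_nonneg.2 hs.2)
    rw [Real.dist_eq, sub_zero, abs_of_pos hs.1]
    exact hs.2.trans_lt htδ
  have h3 : (2 / t ^ 2) • secondAntideriv f t - f 0
      = (2 / t ^ 2) • (secondAntideriv f t - (t ^ 2 / 2) • f 0) := by
    rw [smul_sub, smul_smul, show 2 / t ^ 2 * (t ^ 2 / 2) = 1 by field_simp, one_smul]
  rw [dist_eq_norm, h3, norm_smul, h1, Real.norm_of_nonneg (by positivity)]
  calc 2 / t ^ 2 * ‖∫ s in (0 : ℝ)..t, (t - s) • (f s - f 0)‖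
      ≤ 2 / t ^ 2 * (t ^ 2 / 2 * (ε / 2)) := by gcongr
    _ = ε / 2 := by field_simp
    _ < ε := by linarith

end second_antiderivative

/-! ### Cosine families: commutation, growth, and density of the generator's domain. -/

section cosine

variable {𝕜 : Type*} [RCLike 𝕜] {B : Type*} [NormedAddCommGroup B] [NormedSpace 𝕜 B]
  {T : ℝ → B →L[𝕜] B}

theorem IsCosineFamily.commute (hT : IsCosineFamily T) {s t : ℝ} (hs : 0 ≤ s) (ht : 0 ≤ t) :
    Commute (T s) (T t) := by
  ext x
  have h1 := hT.add_sub s t hs ht x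
  have h2 := hT.add_sub t s ht hs x
  rw [add_comm s t, abs_sub_comm, h1] at h2
  exact (smul_right_injective B (two_ne_zero (α := 𝕜)) h2).symm

theorem IsCosineFamily.two_smul_mul (hT : IsCosineFamily T) {h : ℝ} (hh : 0 ≤ h) (k : ℕ) :
    (2 : 𝕜) • (T h * T ((k + 1 : ℕ) * h)) = T ((k + 2 : ℕ) * h) + T (k * h) := by
  ext x
  have h1 := hT.add_sub ((k + 1 : ℕ) * h) h (by positivity) hh x
  have e1 : h + (k + 1 : ℕ) * h = (k + 2 : ℕ) * h := by push_cast; ring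
  have e2 : |h - (k + 1 : ℕ) * h| = k * h := by
    rw [show h - (k + 1 : ℕ) * h = -(k * h) by push_cast; ring, abs_neg, abs_of_nonneg (by positivity)]
  rw [e1, e2] at h1
  exact h1.symm

theorem IsCosineFamily.continuous_comp_abs (hT : IsCosineFamily T) (x : B) :
    Continuous fun s : ℝ => T |s| x :=
  (hT.strongCont x).comp_continuous continuous_abs fun s => abs_nonneg s

theorem IsCosineFamily.two_smul_apply (hT : IsCosineFamily T) {s t : ℝ} (hs : 0 ≤ s) (ht : 0 ≤ t)
    (x : B) : (2 : 𝕜) • T s (T t x) = T |t + s| x + T |t - s| x := by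
  have h := hT.add_sub t s ht hs x
  rw [← h, abs_sub_comm, add_comm t s, abs_of_nonneg (add_nonneg hs ht)]

theorem IsCosineFamily.exists_norm_le (hT : IsCosineFamily T) [CompleteSpace B] :
    ∃ M ω : ℝ, 1 ≤ M ∧ 0 ≤ ω ∧ ∀ t : ℝ, 0 ≤ t → ‖T t‖ ≤ M * Real.exp (√ω * t) := by
  obtain ⟨K₀, hK₀⟩ := banach_steinhaus (g := fun s : Icc (0 : ℝ) 1 => T s) (fun x => by
    obtain ⟨C, hC⟩ := isCompact_Icc.exists_bound_of_continuousOn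
      ((hT.strongCont x).mono (Icc_subset_Ici_self : Icc (0 : ℝ) 1 ⊆ Ici 0))
    exact ⟨C, fun s => hC s s.2⟩)
  set K := max K₀ 1 with hK
  have hK1 : 1 ≤ K := le_max_right _ _
  have hKn : ∀ s ∈ Icc (0 : ℝ) 1, ‖T s‖ ≤ K := fun s hs => (hK₀ ⟨s, hs⟩).trans (le_max_left _ _)
  -- Induction by T(t) = 2T(1)T(t - 1) - T(|t - 2|); for t ≥ 1 both arguments fall in the range
  -- already treated.
  have hstep : ∀ (n : ℕ) (t : ℝ), 0 ≤ t → t ≤ n + 1 → ‖T t‖ ≤ K * (3 * K) ^ n := by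
    intro n
    induction n with
    | zero =>
      intro t h0 h1
      simpa using hKn t ⟨h0, by simpa using h1⟩
    | succ n ih =>
      intro t h0 h1
      have hmono : K * (3 * K) ^ n ≤ K * (3 * K) ^ (n + 1) := by
        gcongr
        · linarith
        · exact n.le_succ
      rcases le_total t 1 with ht | ht
      · exact ((hKn t ⟨h0, ht⟩).trans (le_mul_of_one_le_right (by linarith)
          (one_le_pow₀ (by linarith))))
      · push_cast at h1
        have hp1 := ih (t - 1) (by linarith) (by linarith)
        have hp2 := ih |t - 2| (abs_nonneg _) (abs_le.2 ⟨by linarith [n.cast_nonneg (α := ℝ)],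
          by linarith⟩)
        refine ContinuousLinearMap.opNorm_le_bound _ (by positivity) fun x => ?_
        have h2 := hT.two_smul_apply zero_le_one (sub_nonneg.2 ht) x
        rw [sub_add_cancel, abs_of_nonneg h0, show t - 1 - 1 = t - 2 by ring] at h2
        have h3 : T t x = (2 : 𝕜) • T 1 (T (t - 1) x) - T |t - 2| x := by
          rw [h2, add_sub_cancel_right]
        rw [h3]
        have h4 : ‖T 1 (T (t - 1) x)‖ ≤ K * (K * (3 * K) ^ n * ‖x‖) :=
          (T 1).le_of_opNorm_le_of_le (hKn 1 (by simp)) ((T (t - 1)).le_of_opNorm_le hp1 x)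
        have h5 := (T |t - 2|).le_of_opNorm_le hp2 x
        calc ‖(2 : 𝕜) • T 1 (T (t - 1) x) - T |t - 2| x‖
            ≤ 2 * (K * (K * (3 * K) ^ n * ‖x‖)) + K * (3 * K) ^ n * ‖x‖ := by
              refine (norm_sub_le _ _).trans (add_le_add ?_ h5)
              rw [norm_smul, RCLike.norm_ofNat]
              gcongr
          _ ≤ 2 * (K * (K * (3 * K) ^ n * ‖x‖)) + K * (K * (3 * K) ^ n * ‖x‖) := by
              have := le_mul_of_one_le_left (by positivity : 0 ≤ K * (3 * K) ^ n * ‖x‖) hK1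
              linarith
          _ = K * (3 * K) ^ (n + 1) * ‖x‖ := by ring
  have hlog : 0 ≤ Real.log (3 * K) := Real.log_nonneg (by linarith)
  -- The square makes √ω = log(3K), turning (3K)^⌊t⌋ into an exponential.
  refine ⟨K, Real.log (3 * K) ^ 2, hK1, by positivity, fun t ht => ?_⟩
  rw [Real.sqrt_sq hlog]
  refine (hstep ⌊t⌋₊ t ht (Nat.lt_floor_add_one t).le).trans ?_
  gcongr
  rw [← Real.rpow_natCast, Real.rpow_def_of_pos (by linarith)]
  exact Real.exp_le_exp.2 (mul_le_mul_of_nonneg_left (Nat.floor_le ht) hlog)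

theorem IsCosineGenerator.apply_mem_graph {A : B →ₗ.[𝕜] B} (hA : IsCosineGenerator T A)
    {P : B →L[𝕜] B} (hP : ∀ t, 0 ≤ t → Commute P (T t)) {x y : B} (hxy : (x, y) ∈ A.graph) :
    (P x, P y) ∈ A.graph := by
  rw [hA] at hxy ⊢
  refine ((P.continuous.tendsto y).comp hxy).congr' ?_
  filter_upwards [self_mem_nhdsWithin] with t ht
  have h := congrArg (fun Q : B →L[𝕜] B => Q x) (hP t (le_of_lt ht)).eq
  change P (T t x) = T t (P x) at h
  simp [h]

theorem opValue_eq_of_mem_graph {A : B →ₗ.[𝕜] B} {x y : B} (h : (x, y) ∈ A.graph) :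
    opValue A x = y := by
  obtain ⟨z, hz, hzy⟩ := (LinearPMap.mem_graph_iff A).1 h
  simp only at hz hzy
  subst hz
  rw [opValue, dif_pos z.2]
  exact hzy

theorem mem_graph_opValue {A : B →ₗ.[𝕜] B} {x : B} (h : x ∈ A.domain) :
    (x, opValue A x) ∈ A.graph := by
  rw [opValue, dif_pos h]
  exact A.mem_graph ⟨x, h⟩

variable [NormedSpace ℝ B]

theorem IsCosineFamily.two_smul_secondAntideriv (hT : IsCosineFamily T) {s t : ℝ} (hs : 0 ≤ s)
    (ht : 0 ≤ t) (x : B) :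
    (2 : ℝ) • secondAntideriv (fun r => T |r| (T s x)) t
      = secondAntideriv (fun r => T |r| x) (s + t) + secondAntideriv (fun r => T |r| x) (s - t)
        - (2 : ℝ) • secondAntideriv (fun r => T |r| x) s := by
  rw [← integral_sub_smul_symm (hT.continuous_comp_abs x), secondAntideriv,
    ← intervalIntegral.integral_smul]
  refine intervalIntegral.integral_congr fun r hr => ?_
  rw [uIcc_of_le ht] at hr
  have h := hT.two_smul_apply hr.1 hs x
  rw [← h, abs_of_nonneg hr.1, smul_comm]
  congr 1
  rw [two_smul, two_smul]

variable [IsScalarTower ℝ 𝕜 B] [CompleteSpace B]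

theorem IsCosineFamily.apply_secondAntideriv (hT : IsCosineFamily T) {s : ℝ} (hs : 0 ≤ s) (t : ℝ)
    (x : B) :
    T s (secondAntideriv (fun r => T |r| x) t) = secondAntideriv (fun r => T |r| (T s x)) t := by
  have hc := hT.continuous_comp_abs x
  have h := ((T s).restrictScalars ℝ).intervalIntegral_comp_comm (a := 0) (b := t)
    (intervalIntegrable_sub_smul hc t 0 t)
  rw [secondAntideriv, secondAntideriv]
  refine h.symm.trans (intervalIntegral.integral_congr fun r hr => ?_)
  rw [map_smul]
  congr 1
  exact congrArg (fun Q : B →L[𝕜] B => Q x) (hT.commute hs (abs_nonneg r)).eq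

/-- Write J for the second antiderivative of T(|r|)x. Twice that of T(|r|)T(s)x at t is J(s + t) +
J(s - t) - 2J(s). Since J is even, exchanging s and t alters only the last term. -/
theorem IsCosineFamily.apply_secondAntideriv_sub (hT : IsCosineFamily T) {s t : ℝ} (hs : 0 ≤ s)
    (ht : 0 ≤ t) (x : B) :
    T t (secondAntideriv (fun r => T |r| x) s) - secondAntideriv (fun r => T |r| x) s
      = secondAntideriv (fun r => T |r| (T s x - x)) t := by
  have h1 := hT.two_smul_secondAntideriv hs ht x
  have h2 := hT.two_smul_secondAntideriv ht hs x
  have heven := secondAntideriv_even (f := fun r => T |r| x) (by simp) (s - t)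
  rw [neg_sub] at heven
  rw [add_comm t s, heven] at h2
  have h3 : secondAntideriv (fun r => T |r| (T s x - x)) t
      = secondAntideriv (fun r => T |r| (T s x)) t - secondAntideriv (fun r => T |r| x) t := by
    have hc1 := hT.continuous_comp_abs x
    have hc2 := hT.continuous_comp_abs (T s x)
    simp only [secondAntideriv, map_sub, smul_sub]
    exact intervalIntegral.integral_sub (intervalIntegrable_sub_smul hc2 t 0 t)
      (intervalIntegrable_sub_smul hc1 t 0 t)
  rw [hT.apply_secondAntideriv ht, h3]
  refine smul_right_injective B (two_ne_zero (α := ℝ)) ?_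
  simp only [smul_sub]
  rw [h1, h2]
  abel

/-- By the exchange identity, the difference quotient is a normalized second antiderivative of
T(|r|)(T(s)x - x), which tends to the value at r = 0. -/
theorem IsCosineGenerator.secondAntideriv_mem_graph (hT : IsCosineFamily T) {A : B →ₗ.[𝕜] B}
    (hA : IsCosineGenerator T A) {s : ℝ} (hs : 0 ≤ s) (x : B) :
    (secondAntideriv (fun r => T |r| x) s, T s x - x) ∈ A.graph := by
  rw [hA]
  have h := tendsto_two_div_sq_smul_secondAntideriv (hT.continuous_comp_abs (T s x - x))
  have h0 : T |0| (T s x - x) = T s x - x := by rw [abs_zero, hT.zero]; rfl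
  rw [h0] at h
  refine h.congr' ?_
  filter_upwards [self_mem_nhdsWithin] with t ht
  rw [← hT.apply_secondAntideriv_sub hs (le_of_lt ht), RCLike.real_smul_eq_coe_smul (K := 𝕜)]

/-- The normalized second antiderivatives of T(|r|)x lie in the domain and tend to x. -/
theorem IsCosineGenerator.dense_domain (hT : IsCosineFamily T) {A : B →ₗ.[𝕜] B}
    (hA : IsCosineGenerator T A) : Dense (A.domain : Set B) := by
  intro x
  have h := tendsto_two_div_sq_smul_secondAntideriv (hT.continuous_comp_abs x)
  have h0 : T |0| x = x := by rw [abs_zero, hT.zero]; rfl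
  rw [h0] at h
  refine mem_closure_of_tendsto h ?_
  filter_upwards [self_mem_nhdsWithin] with s hs
  rw [RCLike.real_smul_eq_coe_smul (K := 𝕜)]
  exact A.domain.smul_mem _
    (LinearPMap.mem_domain_of_mem_graph (hA.secondAntideriv_mem_graph hT (le_of_lt hs) x))

end cosine

/-! ### Strong limits, locally uniform in time. -/

theorem continuousOn_Ici_zero_of_Icc {X : Type*} [TopologicalSpace X] {f : ℝ → X}
    (h : ∀ τ : ℝ, ContinuousOn f (Icc 0 τ)) : ContinuousOn f (Ici 0) := by
  intro t ht
  refine (h (t + 1) t ⟨ht, by linarith⟩).mono_of_mem_nhdsWithin ?_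
  filter_upwards [self_mem_nhdsWithin, nhdsWithin_le_nhds (Iio_mem_nhds (lt_add_one t))] with s h1 h2
  exact ⟨h1, le_of_lt h2⟩

section strongLimit

variable {𝕜 : Type*} [RCLike 𝕜] {B : Type*} [NormedAddCommGroup B] [NormedSpace 𝕜 B]

/-- Uniform convergence of bounded families on a dense set extends to the whole space. -/
theorem uniformCauchySeqOn_of_dense {s : Set ℝ} {S : ℕ → ℝ → B →L[𝕜] B} {K : ℝ}
    (hK : ∀ n, ∀ t ∈ s, ‖S n t‖ ≤ K) {D : Set B} (hD : Dense D)
    (h : ∀ x ∈ D, UniformCauchySeqOn (fun n t => S n t x) atTop s) (x : B) :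
    UniformCauchySeqOn (fun n t => S n t x) atTop s := by
  rw [Metric.uniformCauchySeqOn_iff]
  intro ε hε
  rcases s.eq_empty_or_nonempty with rfl | ⟨t₀, ht₀⟩
  · exact ⟨0, by simp⟩
  have hK0 : 0 ≤ K := (norm_nonneg _).trans (hK 0 t₀ ht₀)
  obtain ⟨y, hy, hxy⟩ := Metric.dense_iff.1 hD x (ε / (3 * (K + 1))) (by positivity)
  rw [Metric.mem_ball, dist_eq_norm] at hy
  obtain ⟨N, hN⟩ := Metric.uniformCauchySeqOn_iff.1 (h y hxy) (ε / 3) (by positivity)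
  refine ⟨N, fun m hm n hn t ht => ?_⟩
  have hclose : ∀ k, ‖S k t (y - x)‖ ≤ ε / 3 := by
    intro k
    refine ((S k t).le_of_opNorm_le_of_le (hK k t ht) hy.le).trans ?_
    rw [mul_div_assoc', div_le_div_iff₀ (by positivity) (by positivity)]
    nlinarith
  have h1 := hN m hm n hn t ht
  rw [dist_eq_norm] at h1 ⊢
  have e : S m t x - S n t x = (S m t y - S n t y) - S m t (y - x) + S n t (y - x) := by
    simp only [map_sub]
    abel
  rw [e]
  calc _ ≤ ‖S m t y - S n t y‖ + ‖S m t (y - x)‖ + ‖S n t (y - x)‖ :=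
        (norm_add_le _ _).trans (add_le_add_left (norm_sub_le _ _) _)
    _ < ε := by linarith [hclose m, hclose n]

theorem exists_strong_limit [CompleteSpace B] {S : ℕ → ℝ → B →L[𝕜] B}
    (h : ∀ (x : B) (τ : ℝ), UniformCauchySeqOn (fun n t => S n t x) atTop (Icc 0 τ)) :
    ∃ S' : ℝ → B →L[𝕜] B, ∀ (x : B) (τ : ℝ),
      TendstoUniformlyOn (fun n t => S n t x) (fun t => S' t x) atTop (Icc 0 τ) := by
  have hlim : ∀ t : ℝ, ∃ P : B →L[𝕜] B, 0 ≤ t → ∀ x, Tendsto (fun n => S n t x) atTop (𝓝 (P x)) := by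
    intro t
    by_cases ht : 0 ≤ t
    · have hx : ∀ x, ∃ y, Tendsto (fun n => S n t x) atTop (𝓝 y) := fun x =>
        cauchySeq_tendsto_of_complete ((h x t).cauchySeq ⟨ht, le_rfl⟩)
      choose f hf using hx
      exact ⟨continuousLinearMapOfTendsto (fun n => S n t) (tendsto_pi_nhds.2 hf), fun _ => hf⟩
    · exact ⟨0, fun h => absurd h ht⟩
  choose S' hS' using hlim
  exact ⟨S', fun x τ => (h x τ).tendstoUniformlyOn_of_tendsto fun t ht => hS' t ht.1 x⟩

end strongLimit

/-! ### Second difference quotients and passage to the limit in the resolvent equation. -/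

section approximation

variable {𝕜 : Type*} [RCLike 𝕜] {B : Type*} [NormedAddCommGroup B] [NormedSpace 𝕜 B]
  {T : ℝ → B →L[𝕜] B}

/-- The second difference quotient `2 (T(h) - I) / h ^ 2` of a cosine family. -/
noncomputable def cosineQuotient (T : ℝ → B →L[𝕜] B) (h : ℝ) : B →L[𝕜] B :=
  ((2 / h ^ 2 : ℝ) : 𝕜) • (T h - 1)

theorem IsCosineFamily.commute_cosineQuotient (hT : IsCosineFamily T) {h s : ℝ} (hh : 0 ≤ h)
    (hs : 0 ≤ s) : Commute (cosineQuotient T h) (T s) :=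
  ((hT.commute hh hs).sub_left (Commute.one_left _)).smul_left _

theorem IsCosineFamily.commute_cosineQuotient_cosineQuotient (hT : IsCosineFamily T) {h s : ℝ}
    (hh : 0 ≤ h) (hs : 0 ≤ s) : Commute (cosineQuotient T h) (cosineQuotient T s) :=
  ((hT.commute_cosineQuotient hh hs).sub_right (Commute.one_right _)).smul_right _

theorem IsCosineGenerator.tendsto_cosineQuotient {A : B →ₗ.[𝕜] B} (hA : IsCosineGenerator T A)
    {h : ℕ → ℝ} (hpos : ∀ n, 0 < h n) (hlim : Tendsto h atTop (𝓝 0)) {x y : B}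
    (hxy : (x, y) ∈ A.graph) : Tendsto (fun n => cosineQuotient T (h n) x) atTop (𝓝 y) :=
  ((hA x y).1 hxy).comp (tendsto_nhdsWithin_iff.2 ⟨hlim, Eventually.of_forall hpos⟩)

variable [NormedSpace ℝ B] [IsScalarTower ℝ 𝕜 B]

theorem IsCosineFamily.hasResolventBound_cosineQuotient (hT : IsCosineFamily T)
    {M w h α : ℝ} (hM : 1 ≤ M) (hw : 0 ≤ w) (hTn : ∀ t : ℝ, 0 ≤ t → ‖T t‖ ≤ M * Real.exp (w * t))
    (hh : 0 < h) (hwh : w * h ≤ 1 / 2) (hα : 0 < α) (hα2 : α < 2) :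
    HasResolventBound α ((2 * w ^ 2) ^ (1 / α))
      (36 * M / ((1 + Real.cos (Real.pi * α / 2)) / 2)) (complexDual (cosineQuotient T h)) := by
  have h1 := hasResolventBound_secondDifference (T := fun k : ℕ => complexDual (T (k * h)))
    (M := M) (w := w) (h := h) (α := α) ?_ ?_ ?_ hM hw hh hwh ?_ hα hα2
  · rw [cosineQuotient, complexDual_smul, complexDual_sub, complexDual_one]
    simpa using h1
  · simp only [Nat.cast_zero, zero_mul, hT.zero]
    rfl
  · intro k
    have hc := (hT.commute hh.le (by positivity : 0 ≤ ((k + 1 : ℕ) : ℝ) * h)).eq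
    have e := congrArg complexDual (hT.two_smul_mul hh.le k)
    rw [AddMonoidHom.map_add, hc, show (2 : 𝕜) = ((2 : ℝ) : 𝕜) from (RCLike.ofReal_ofNat 2).symm,
      complexDual_smul, complexDual_mul] at e
    rw [← e, Nat.cast_one, one_mul, Complex.ofReal_ofNat]
  · intro k
    exact (hT.commute (by positivity) (by positivity)).complexDual
  · intro k
    refine (norm_complexDual_le _).trans ((hTn _ (by positivity)).trans (le_of_eq ?_))
    rw [← Real.exp_nat_mul]
    ring_nf

variable [CompleteSpace B]

/-- The limit commutes with every T(s), hence preserves the graph of A. The integral equation is the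
limit of those for P n, with P n moved inside the family to act on x and dominated convergence
applied. -/
theorem isFracResolvent_of_tendsto {A : B →ₗ.[𝕜] B}
    (hA : IsCosineGenerator T A) {α β K : ℝ} (hα : 0 < α) (hβ : 0 ≤ β) {P : ℕ → B →L[𝕜] B}
    (hPT : ∀ n s, 0 ≤ s → Commute (P n) (T s))
    (hPA : ∀ x y, (x, y) ∈ A.graph → Tendsto (fun n => P n x) atTop (𝓝 y))
    (hK : ∀ n t, 0 ≤ t → ‖mlFamily 𝕜 α (P n) t‖ ≤ K * Real.exp (β * t)) {S : ℝ → B →L[𝕜] B}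
    (hS : ∀ (x : B) (τ : ℝ),
      TendstoUniformlyOn (fun n t => mlFamily 𝕜 α (P n) t x) (fun t => S t x) atTop (Icc 0 τ)) :
    IsFracResolvent α A S := by
  have hpt : ∀ t, 0 ≤ t → ∀ x, Tendsto (fun n => mlFamily 𝕜 α (P n) t x) atTop (𝓝 (S t x)) :=
    fun t ht x => (hS x t).tendsto_at ⟨ht, le_rfl⟩
  have hcont : ∀ x, ContinuousOn (fun t => S t x) (Ici 0) := fun x =>
    continuousOn_Ici_zero_of_Icc fun τ => (hS x τ).continuousOn (Frequently.of_forall fun n =>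
      ((continuousOn_mlFamily hα (P n)).clm_apply continuousOn_const).mono Icc_subset_Ici_self)
  have hcomm : ∀ t, 0 ≤ t → ∀ s, 0 ≤ s → Commute (S t) (T s) := by
    intro t ht s hs
    ext x
    refine tendsto_nhds_unique (hpt t ht (T s x)) ?_
    refine (((T s).continuous.tendsto _).comp (hpt t ht x)).congr fun n => ?_
    exact congrArg (fun Q : B →L[𝕜] B => Q x) (commute_mlFamily hα (hPT n s hs).symm ht).eq
  have hgraph : ∀ t, 0 ≤ t → ∀ x ∈ A.domain, (S t x, S t (opValue A x)) ∈ A.graph :=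
    fun t ht x hx => hA.apply_mem_graph (hcomm t ht) (mem_graph_opValue hx)
  have hcommA : ∀ t, 0 ≤ t → ∀ x ∈ A.domain, opValue A (S t x) = S t (opValue A x) :=
    fun t ht x hx => opValue_eq_of_mem_graph (hgraph t ht x hx)
  refine ⟨hcont, ?_, fun t ht x hx => LinearPMap.mem_domain_of_mem_graph (hgraph t ht x hx), hcommA,
    fun x hx t ht => ?_⟩
  · ext x
    refine tendsto_nhds_unique (hpt 0 le_rfl x) (tendsto_const_nhds.congr fun n => ?_)
    rw [mlFamily_zero hα]
    rfl
  · set y := opValue A x with hy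
    have hPx := hPA x y (mem_graph_opValue hx)
    obtain ⟨b, hb⟩ := hPx.norm.bddAbove_range
    have hb' : ∀ n, ‖P n x‖ ≤ b := fun n => hb ⟨n, rfl⟩
    have hK0 : 0 ≤ K := by simpa using (norm_nonneg _).trans (hK 0 0 le_rfl)
    -- Both the family and its argument P n x vary with n; the uniform bound absorbs the variation
    -- of the argument.
    have hSy : ∀ τ, 0 ≤ τ →
        Tendsto (fun n => mlFamily 𝕜 α (P n) τ (P n x)) atTop (𝓝 (S τ y)) := by
      intro τ hτ
      have h1 : Tendsto (fun n => mlFamily 𝕜 α (P n) τ (P n x - y)) atTop (𝓝 0) := by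
        refine squeeze_zero_norm (a := fun n => K * Real.exp (β * τ) * ‖P n x - y‖)
          (fun n => ContinuousLinearMap.le_of_opNorm_le _ (hK n τ hτ) _) ?_
        have h2 := (tendsto_iff_norm_sub_tendsto_zero.1 hPx).const_mul (K * Real.exp (β * τ))
        rwa [mul_zero] at h2
      have h3 := h1.add (hpt τ hτ y)
      rw [zero_add] at h3
      exact h3.congr fun n => by simp
    have hint : Tendsto (fun n => ∫ τ in (0 : ℝ)..t,
        fracKernel α (t - τ) • mlFamily 𝕜 α (P n) τ (P n x)) atTop
        (𝓝 (∫ τ in (0 : ℝ)..t, fracKernel α (t - τ) • S τ y)) := by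
      refine intervalIntegral.tendsto_integral_filter_of_dominated_convergence
        (fun τ => fracKernel α (t - τ) * (K * Real.exp (β * t) * b)) ?_ ?_ ?_ ?_
      · refine Eventually.of_forall fun n => ?_
        have h1 := (intervalIntegrable_fracKernel hα t).aestronglyMeasurable
        rw [uIoc_of_le ht]
        refine h1.smul (ContinuousOn.aestronglyMeasurable ?_ measurableSet_Ioc)
        exact ((continuousOn_mlFamily hα (P n)).clm_apply continuousOn_const).mono
          fun τ hτ => hτ.1.le
      · refine Eventually.of_forall fun n => Eventually.of_forall fun τ hτ => ?_
        rw [uIoc_of_le ht] at hτ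
        have h1 := fracKernel_nonneg hα (sub_nonneg.2 hτ.2)
        rw [norm_smul, Real.norm_of_nonneg h1]
        refine mul_le_mul_of_nonneg_left ?_ h1
        refine ContinuousLinearMap.le_of_opNorm_le_of_le _ ((hK n τ hτ.1.le).trans ?_) (hb' n)
        have := hτ.2
        gcongr
      · exact (intervalIntegrable_fracKernel hα t).mul_const _
      · refine Eventually.of_forall fun τ hτ => ?_
        rw [uIoc_of_le ht] at hτ
        exact (hSy τ hτ.1.le).const_smul _
    have heq : ∫ τ in (0 : ℝ)..t, fracKernel α (t - τ) • opValue A (S τ x)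
        = ∫ τ in (0 : ℝ)..t, fracKernel α (t - τ) • S τ y := by
      refine intervalIntegral.integral_congr fun τ hτ => ?_
      rw [uIcc_of_le ht] at hτ
      simp only [hcommA τ hτ.1 x hx, hy]
    rw [heq]
    refine tendsto_nhds_unique (hpt t ht x) ((hint.const_add x).congr fun n => ?_)
    rw [mlFamily_apply_eq_add_integral hα (P n) ht x]
    congr 1
    refine intervalIntegral.integral_congr fun τ hτ => ?_
    rw [uIcc_of_le ht] at hτ
    have h1 := congrArg (fun Q : B →L[𝕜] B => Q x)
      (commute_mlFamily (𝕜 := 𝕜) hα (Commute.refl (P n)) hτ.1).eq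
    exact congrArg (fun z => fracKernel α (t - τ) • z) h1.symm

end approximation

/-! ### The approximation theorem. -/

theorem theorem6 {𝕜 : Type*} [RCLike 𝕜] {B : Type*} [NormedAddCommGroup B] [NormedSpace 𝕜 B]
    [NormedSpace ℝ B] [IsScalarTower ℝ 𝕜 B] [CompleteSpace B]
    (T : ℝ → B →L[𝕜] B) (hT : IsCosineFamily T)
    (A : B →ₗ.[𝕜] B) (hA : IsCosineGenerator T A) :
    (∃ M ω : ℝ, 1 ≤ M ∧ 0 ≤ ω ∧ ∀ t : ℝ, 0 ≤ t → ‖T t‖ ≤ M * Real.exp (√ω * t)) ∧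
    ∀ M ω : ℝ, 1 ≤ M → 0 ≤ ω →
      (∀ t : ℝ, 0 ≤ t → ‖T t‖ ≤ M * Real.exp (√ω * t)) →
      ∀ α : ℝ, 0 < α → α < 2 →
        ∃ S : ℝ → B →L[𝕜] B, IsFracResolvent α A S ∧
          ∃ C : ℝ, 0 < C ∧
          ∃ (An : ℕ → B →L[𝕜] B) (Sn : ℕ → ℝ → B →L[𝕜] B),
            (∀ n : ℕ, IsFracResolvent α (boundedOp (An n)) (Sn n)) ∧
            (∀ (n : ℕ) (t : ℝ), 0 ≤ t →
              ‖Sn n t‖ ≤ M * C * Real.exp ((2 * ω) ^ (1 / α) * t)) ∧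
            (∀ (x : B) (t : ℝ), 0 ≤ t →
              Tendsto (fun n => Sn n t x) atTop (𝓝 (S t x))) ∧
            (∀ (x : B) (K : Set ℝ), K ⊆ Ici 0 → IsCompact K →
              TendstoUniformlyOn (fun n t => Sn n t x) (fun t => S t x) atTop K) := by
  refine ⟨hT.exists_norm_le, fun M ω hM hω hTn α hα hα2 => ?_⟩
  set w := √ω with hw
  have hw0 : 0 ≤ w := Real.sqrt_nonneg ω
  have hw2 : w ^ 2 = ω := Real.sq_sqrt hω
  -- The factor 1/(1 + 2w) ensures w h n ≤ 1/2 for every n, as the resolvent estimate requires.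
  set h : ℕ → ℝ := fun n => 1 / ((n : ℝ) + 1) * (1 / (1 + 2 * w)) with hh
  have hpos : ∀ n, 0 < h n := fun n => by positivity
  have hlim : Tendsto h atTop (𝓝 0) := by
    have := (tendsto_one_div_add_atTop_nhds_zero_nat (𝕜 := ℝ)).mul_const (1 / (1 + 2 * w))
    rwa [zero_mul] at this
  have hwh : ∀ n, w * h n ≤ 1 / 2 := by
    intro n
    have h1 : h n ≤ 1 / (1 + 2 * w) := by
      refine mul_le_of_le_one_left (by positivity) ?_
      rw [div_le_one (by positivity)]
      linarith [n.cast_nonneg (α := ℝ)]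
    calc w * h n ≤ w * (1 / (1 + 2 * w)) := by gcongr
      _ ≤ 1 / 2 := by
        rw [mul_one_div, div_le_div_iff₀ (by positivity) two_pos]
        linarith
  set β := (2 * ω) ^ (1 / α) with hβ
  have hβ0 : 0 ≤ β := by positivity
  set P : ℕ → B →L[𝕜] B := fun n => cosineQuotient T (h n) with hP
  set C₀ := 36 * M / ((1 + Real.cos (Real.pi * α / 2)) / 2) with hC₀
  have hres : ∀ n, HasResolventBound α β C₀ (complexDual (P n)) := by
    intro n
    have := hT.hasResolventBound_cosineQuotient hM hw0 hTn (hpos n) (hwh n) hα hα2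
    rwa [hw2] at this
  have hC₀0 : 0 ≤ C₀ := (hres 0).nonneg
  set C := 1 + Real.exp 1 * (|1 - α| * C₀ + |α| * C₀ ^ 2) with hC
  have hC0 : 0 < C := by positivity
  have hbound : ∀ n t, 0 ≤ t → ‖mlFamily 𝕜 α (P n) t‖ ≤ C * Real.exp (β * t) :=
    fun n t ht => norm_mlFamily_le_of_complexDual hα hβ0 (hres n) ht
  have hPA : ∀ x y, (x, y) ∈ A.graph → Tendsto (fun n => P n x) atTop (𝓝 y) :=
    fun x y hxy => hA.tendsto_cosineQuotient hpos hlim hxy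
  have hcauchy : ∀ (x : B) (τ : ℝ),
      UniformCauchySeqOn (fun n t => mlFamily 𝕜 α (P n) t x) atTop (Icc 0 τ) := by
    intro x τ
    refine uniformCauchySeqOn_of_dense (K := C * Real.exp (β * τ)) (fun n t ht => ?_)
      (hA.dense_domain hT) (fun y hy => ?_) x
    · refine (hbound n t ht.1).trans ?_
      have := ht.2
      gcongr
    -- |τ| allows for negative τ, where the interval is empty; L + 1 below makes the divisor
    -- positive.
    · set L := Real.exp 1 * (|1 - α| * C₀ ^ 2 + |α| * (2 * C₀ ^ 3)) * (|τ| ^ α * Real.exp (β * |τ|))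
        with hL
      have hL0 : 0 ≤ L := by positivity
      rw [Metric.uniformCauchySeqOn_iff]
      intro ε hε
      obtain ⟨N, hN⟩ := Metric.cauchySeq_iff.1 (hPA y _ (mem_graph_opValue hy)).cauchySeq
        (ε / (L + 1)) (by positivity)
      refine ⟨N, fun m hm n hn t ht => ?_⟩
      have h1 := hN m hm n hn
      rw [dist_eq_norm, lt_div_iff₀ (by positivity)] at h1
      rw [dist_eq_norm]
      refine (norm_mlFamily_sub_apply_le hα hβ0
        (hT.commute_cosineQuotient_cosineQuotient (hpos m).le (hpos n).le) (hres m) (hres n)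
        ht.1 y).trans_lt (lt_of_le_of_lt ?_ h1)
      have h2 : t ≤ |τ| := ht.2.trans (le_abs_self τ)
      have h3 := ht.1
      calc _ ≤ L * ‖P m y - P n y‖ := by rw [hL]; gcongr
        _ ≤ ‖P m y - P n y‖ * (L + 1) := by nlinarith [norm_nonneg (P m y - P n y)]
  obtain ⟨S, hS⟩ := exists_strong_limit hcauchy
  refine ⟨S, isFracResolvent_of_tendsto hA hα hβ0
    (fun n s hs => hT.commute_cosineQuotient (hpos n).le hs) hPA hbound hS, C, hC0, P,
    fun n => mlFamily 𝕜 α (P n), fun n => isFracResolvent_mlFamily hα (P n), fun n t ht => ?_,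
    fun x t ht => (hS x t).tendsto_at ⟨ht, le_rfl⟩, fun x K hK hKc => ?_⟩
  · refine (hbound n t ht).trans ?_
    gcongr
    -- C already contains M through C₀, so the required factor M costs nothing, as M ≥ 1.
    exact le_mul_of_one_le_left hC0.le hM
  · obtain ⟨τ, hτ⟩ := hKc.bddAbove
    exact (hS x τ).mono fun t ht => ⟨hK ht, hτ ht⟩
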